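/- All graphs are finite, simple and undirected; $e(G)$ is the number of edges of $G$, and a $k$-edge-connected graph has at least two vertices when $k\ge 2$. For $k\ge 2$, an edge-coloring of $G$ (adjacent edges may share a color) is an $MC_k$-coloring if every two distinct vertices of $G$ are connected by at least $k$ pairwise edge-disjoint monochromatic paths (different paths may have different colors); $mc_k(G)$ is the maximum number of colors used by an $MC_k$-coloring of $G$. A minimal $k$-edge-connected spanning subgraph of $G$ is a $k$-edge-connected spanning subgraph from which no edge can be deleted without destroying $k$-edge-connectedness; a minimum one is a minimal one with the fewest edges. The formula $$mc_k(G)=e(G)-e(H)+\left\lfloor \tfrac{k}{2}\right\rfloor \quad\text{for every minimum $k$-edge-connected spanning subgraph $H$ of $G$}$$ holds in each of the following cases. 1. $k=2$ and $G$ is any $2$-edge-connected graph; that is, $mc_2(G)=e(G)-e(H)+1$. 2. $k=2n$ with $n\ge 2$ and $G=K_{2n+1}$. This graph is $2n$-edge-connected, and $mc_{2n}(K_{2n+1})=n$. 3. $G=K_{k,n}$ with $n\ge k$, where either $k\ge 4$ is even or $k=3$. This graph is $k$-edge-connected, and $mc_k(K_{k,n})=k/2$ if $k\ge 4$ is even,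 while $mc_3(K_{3,n})=1$. -/

import Mathlib

namespace SimpleGraph

/-- A walk is monochromatic for the edge-coloring `Γ` if any two of its edges have the same color. -/
def IsMonochromatic {V C : Type*} {G : SimpleGraph V} (Γ : G.edgeSet → C) {u v : V}
    (p : G.Walk u v) : Prop :=
  ∀ e f : G.edgeSet, (e : Sym2 V) ∈ p.edges → (f : Sym2 V) ∈ p.edges → Γ e = Γ f

/-- `Γ` is a monochromatic `k`-edge-connection coloring: every two distinct vertices are joined by
`k` pairwise edge-disjoint monochromatic paths (different paths may have different colors). -/
def IsMCColoring {V C : Type*} {G : SimpleGraph V} (k : ℕ) (Γ : G.edgeSet → C) : Prop :=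
  ∀ u v : V, u ≠ v → ∃ P : Fin k → G.Path u v,
    (∀ i, IsMonochromatic Γ (P i : G.Walk u v)) ∧
    ∀ i j, i ≠ j → List.Disjoint (P i : G.Walk u v).edges (P j : G.Walk u v).edges

/-- The numbers `r` of colors such that some monochromatic `k`-edge-connection coloring of `G`
uses exactly `r` colors. -/
def mcColorCounts {V : Type*} (G : SimpleGraph V) (k : ℕ) : Set ℕ :=
  {r | ∃ Γ : G.edgeSet → Fin r, Function.Surjective Γ ∧ IsMCColoring k Γ}

/-- The monochromatic `k`-edge-connection number `mc_k(G)`: the maximum number of colors in a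
monochromatic `k`-edge-connection coloring (see `mc_isGreatest`). -/
noncomputable def mc {V : Type*} (G : SimpleGraph V) (k : ℕ) : ℕ :=
  sSup (mcColorCounts G k)

/-- On a finite graph that has a monochromatic `k`-edge-connection coloring, the supremum defining
`mc_k(G)` is a maximum. -/
theorem mc_isGreatest {V : Type*} [Finite V] (G : SimpleGraph V) (k : ℕ)
    (h : (mcColorCounts G k).Nonempty) : IsGreatest (mcColorCounts G k) (mc G k) := by
  have hb : BddAbove (mcColorCounts G k) := by
    refine ⟨Nat.card G.edgeSet, ?_⟩
    rintro r ⟨Γ, hΓ, -⟩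
    simpa using Nat.card_le_card_of_surjective Γ hΓ
  exact ⟨Nat.sSup_mem h hb, fun _ hr => le_csSup hb hr⟩

/-- The number of edges `e(G)` of a finite graph. -/
noncomputable def numEdges {V : Type*} (G : SimpleGraph V) : ℕ := G.edgeSet.ncard

/-- `H` is a minimal `k`-edge-connected spanning subgraph of `G`: it is `k`-edge-connected, and no
edge of it can be deleted without destroying this property. -/
def IsMinimalECSpanning {V : Type*} (G : SimpleGraph V) (k : ℕ) (H : SimpleGraph V) : Prop :=
  H ≤ G ∧ H.IsEdgeConnected k ∧ ∀ e ∈ H.edgeSet, ¬ (H.deleteEdges {e}).IsEdgeConnected k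

/-- `H` is a minimum `k`-edge-connected spanning subgraph of `G`: a minimal one with the smallest
number of edges. -/
def IsMinimumECSpanning {V : Type*} (G : SimpleGraph V) (k : ℕ) (H : SimpleGraph V) : Prop :=
  IsMinimalECSpanning G k H ∧
    ∀ H' : SimpleGraph V, IsMinimalECSpanning G k H' → numEdges H ≤ numEdges H'

/-- The formula `mc_k(G) = e(G) - e(H) + ⌊k/2⌋` for every minimum `k`-edge-connected spanning
subgraph `H` of `G`. -/
def MCFormula {V : Type*} (G : SimpleGraph V) (k : ℕ) : Prop :=
  ∀ H : SimpleGraph V, IsMinimumECSpanning G k H →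
    (mc G k : ℤ) = (numEdges G : ℤ) - (numEdges H : ℤ) + ((k / 2 : ℕ) : ℤ)

end SimpleGraph

/-!
For `k = 2`, give the edges of a minimum 2-edge-connected spanning subgraph `H` one color and all
other edges distinct colors: this uses `e(G) - e(H) + 1` colors. Conversely, the components of the
color classes of an `MC_2`-coloring are edge-disjoint subgraphs `C i`, and it suffices to find a
2-edge-connected spanning subgraph with at most `1 + ∑ i, (e(C i) - 1)` edges. Grow one from a
largest class `C s`. Each bridge of `C s` is assigned to another class containing both its ends, as
a second path between them is monochromatic; that class provides an edge or an ear to close the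
bridge. The vertices outside `C s` are absorbed by ears, each of which uses one edge more than it
has new vertices, and a bridge that survives costs one further edge. The edges saved by the classes,
`C s` being the largest one, balance these costs.

In `K_{2n+1}` and `K_{k,n}` every edge has an end of degree `k`, so a `k`-edge-connected spanning
subgraph is the whole graph. The `k` edge-disjoint paths leaving a vertex of degree `k` use all its
edges, so a color occurs equally often at all such vertices; if it occurred only once, its class
would be a star, which is impossible. Hence there are at most `k / 2` colors, and this is attained
by a decomposition into 2-edge-connected spanning subgraphs (for `k = 3`, by a single color).
-/

namespace MonochromaticConnection

open SimpleGraph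

/-! ### Deleting one edge -/

section EdgeDeletion

variable {V : Type*} {S H : SimpleGraph V} {e : Sym2 V} {a b c d x y : V}

/-- The edge `e` separates `a` from `b`: every walk of `S` from `a` to `b` passes through `e`. -/
def Separates (S : SimpleGraph V) (e : Sym2 V) (a b : V) : Prop :=
  ¬ (S.deleteEdges {e}).Reachable a b

lemma Separates.symm (h : Separates S e a b) : Separates S e b a := fun hr => h hr.symm

lemma Separates.ne (h : Separates S e a b) : a ≠ b := by
  rintro rfl
  exact h .rfl

lemma le_deleteEdges_singleton (hle : S ≤ H) (he : e ∉ S.edgeSet) : S ≤ H.deleteEdges {e} :=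
  fun _ _ huv => deleteEdges_adj.2 ⟨hle huv, fun h => he (Set.mem_singleton_iff.1 h ▸ huv)⟩

lemma Separates.mem_edgeSet (h : Separates S e a b) (hr : S.Reachable a b) : e ∈ S.edgeSet :=
  by_contra fun he => h (hr.mono (le_deleteEdges_singleton le_rfl he))

lemma reachable_deleteEdges_of_not_reachable (h : S.Reachable a b) (hx : ¬ S.Reachable a x) :
    (S.deleteEdges {s(x, y)}).Reachable a b := by
  classical
  obtain ⟨p⟩ := h
  exact (p.toDeleteEdge _ fun he =>
    hx (p.takeUntil x (p.fst_mem_support_of_mem_edges he)).reachable).reachable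

lemma reachable_deleteEdges_or (h : S.Reachable a x) (y : V) :
    (S.deleteEdges {s(x, y)}).Reachable a x ∨ (S.deleteEdges {s(x, y)}).Reachable a y := by
  obtain ⟨p⟩ := h
  induction p with
  | nil => exact Or.inl .rfl
  | @cons u v w h p ih =>
    by_cases he : s(u, v) = s(w, y)
    · rcases Sym2.eq_iff.1 he with ⟨rfl, -⟩ | ⟨rfl, -⟩
      · exact Or.inl .rfl
      · exact Or.inr .rfl
    · have hadj : (S.deleteEdges {s(w, y)}).Adj u v := deleteEdges_adj.2 ⟨h, he⟩
      exact ih.imp hadj.reachable.trans hadj.reachable.trans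

lemma reachable_deleteEdges_three (hab : S.Reachable a b) (hac : S.Reachable a c) (e : Sym2 V) :
    (S.deleteEdges {e}).Reachable a b ∨ (S.deleteEdges {e}).Reachable a c ∨
      (S.deleteEdges {e}).Reachable b c := by
  induction e with
  | _ x y =>
  by_cases hax : S.Reachable a x
  · rcases reachable_deleteEdges_or hax y with h1 | h1 <;>
    rcases reachable_deleteEdges_or (hab.symm.trans hax) y with h2 | h2 <;>
    rcases reachable_deleteEdges_or (hac.symm.trans hax) y with h3 | h3
    all_goals first
      | exact Or.inl (h1.trans h2.symm)
      | exact Or.inr (Or.inl (h1.trans h3.symm))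
      | exact Or.inr (Or.inr (h2.trans h3.symm))
  · exact Or.inl (reachable_deleteEdges_of_not_reachable hab hax)

lemma Separates.or_separates (h : Separates S e a b) (c : V) :
    Separates S e a c ∨ Separates S e b c := by
  by_contra! hc
  exact h ((not_not.1 hc.1).trans (not_not.1 hc.2).symm)

lemma reachable_deleteEdges_of_not_isBridge (he : ¬ S.IsBridge e) (h : S.Reachable a b) :
    (S.deleteEdges {e}).Reachable a b := by
  obtain ⟨p⟩ := h
  induction p with
  | nil => exact .rfl
  | @cons u v w h _ ih =>
    refine Reachable.trans ?_ ih
    by_cases huv : s(u, v) = e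
    · subst huv
      exact not_not.1 he
    · exact (deleteEdges_adj.2 ⟨h, huv⟩ : (S.deleteEdges {e}).Adj u v).reachable

lemma exists_separated_by_both {e' : Sym2 V} {a' b' : V} (h : Separates S e a b)
    (h' : Separates S e' a' b') :
    ∃ c ∈ ({a, b} : Set V), ∃ d ∈ ({a', b'} : Set V), Separates S e c d ∧ Separates S e' c d := by
  induction e' with
  | _ x y =>
  obtain ⟨c, hc, hcx⟩ : ∃ c ∈ ({a, b} : Set V), Separates S e c x := by
    simpa only [Set.mem_insert_iff, Set.mem_singleton_iff, exists_eq_or_imp, exists_eq_left]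
      using h.or_separates x
  obtain ⟨d, hd, hcd⟩ : ∃ d ∈ ({a', b'} : Set V), Separates S s(x, y) d c := by
    simpa only [Set.mem_insert_iff, Set.mem_singleton_iff, exists_eq_or_imp, exists_eq_left]
      using h'.or_separates c
  -- A walk from `c` to `d` off `e` cannot visit `x`, so it also avoids the edge `xy`.
  refine ⟨c, hc, d, hd, fun hr => hcd.symm ?_, hcd.symm⟩
  exact (reachable_deleteEdges_of_not_reachable hr hcx).mono (deleteEdges_mono (deleteEdges_le _))

lemma reachable_deleteEdges_of_separates (hle : S ≤ H) (hca : S.Reachable c a)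
    (hcb : S.Reachable c b) (hcd : S.Reachable c d) (hs : Separates S e c d)
    (hr : (H.deleteEdges {e}).Reachable c d) : (H.deleteEdges {e}).Reachable a b := by
  have hmono : S.deleteEdges {e} ≤ H.deleteEdges {e} := deleteEdges_mono hle
  have hc : ∀ u, S.Reachable c u → (H.deleteEdges {e}).Reachable c u := by
    intro u hu
    rcases reachable_deleteEdges_three hcd hu e with h | h | h
    · exact absurd h hs
    · exact h.mono hmono
    · exact hr.trans (h.mono hmono)
  exact (hc a hca).symm.trans (hc b hcb)

lemma exists_isPath_outside {z t : V} (p : S.Walk z t) {T : Set V} (hz : z ∉ T) (ht : t ∈ T) :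
    ∃ z', ∃ x ∈ T, S.Adj z' x ∧ ∃ q : S.Walk z z', q.IsPath ∧
      ∀ y ∈ q.support, y ∉ T ∧ y ∈ p.support := by
  classical
  induction p with
  | nil => exact absurd ht hz
  | @cons u v w h p ih =>
    by_cases hv : v ∈ T
    · exact ⟨u, v, hv, h, Walk.nil, .nil, by simp [hz]⟩
    · obtain ⟨z', x, hx, hadj, q, -, hs⟩ := ih hv ht
      refine ⟨z', x, hx, hadj, (q.cons h).bypass, Walk.bypass_isPath _, fun y hy => ?_⟩
      have hy' := Walk.support_bypass_subset_support _ hy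
      rw [Walk.support_cons, List.mem_cons] at hy' ⊢
      rcases hy' with rfl | hy'
      · exact ⟨hz, Or.inl rfl⟩
      · exact ⟨(hs y hy').1, Or.inr (hs y hy').2⟩

end EdgeDeletion

section Bridges

variable {V : Type*} {H H' S : SimpleGraph V} {A : Finset V} {E : Finset (Sym2 V)} {e : Sym2 V}
  {a b : V}

/-- Any two vertices of `T` are joined by a walk of `H`, which may leave `T`. -/
def ConnectedOn (H : SimpleGraph V) (T : Finset V) : Prop :=
  ∀ u ∈ T, ∀ v ∈ T, H.Reachable u v

lemma ConnectedOn.mono (h : ConnectedOn H A) (hle : H ≤ H') : ConnectedOn H' A :=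
  fun u hu v hv => (h u hu v hv).mono hle

/-- The bridges of a finite graph that are edges of it; a pair of vertices in different components
satisfies `SimpleGraph.IsBridge` as well. -/
noncomputable def bridges [Finite V] (H : SimpleGraph V) : Finset (Sym2 V) :=
  (Set.toFinite {e ∈ H.edgeSet | H.IsBridge e}).toFinset

variable [Finite V]

lemma mem_bridges : e ∈ bridges H ↔ e ∈ H.edgeSet ∧ H.IsBridge e := by
  simp [bridges]

lemma bridges_subset_of_le (hle : H ≤ H') (hr : ∀ ⦃u v⦄, H'.Adj u v → H.Reachable u v) :
    bridges H' ⊆ bridges H := by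
  intro e he
  obtain ⟨heH', hb⟩ := mem_bridges.1 he
  refine mem_bridges.2 ⟨by_contra fun heH => ?_, hb.anti hle⟩
  induction e with
  | _ x y => exact hb ((hr heH').mono (le_deleteEdges_singleton hle heH))

lemma exists_far_injOn [DecidableEq V] (hE : E ⊆ bridges S) (hEA : ∀ e ∈ E, ∀ v ∈ e, v ∈ A)
    (hA : ConnectedOn S A) (ha : a ∈ A) :
    ∃ f : Sym2 V → V, Set.InjOn f E ∧
      ∀ e ∈ E, f e ∈ A.erase a ∧ f e ∈ e ∧ Separates S e a (f e) := by
  have hex : ∀ e : Sym2 V, ∃ v, e ∈ E → v ∈ e ∧ Separates S e a v := by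
    intro e
    by_cases he : e ∈ E
    · induction e with
      | _ x y =>
      have hxy : Separates S s(x, y) x y := (mem_bridges.1 (hE he)).2
      rcases hxy.or_separates a with h | h
      · exact ⟨x, fun _ => ⟨Sym2.mem_mk_left x y, h.symm⟩⟩
      · exact ⟨y, fun _ => ⟨Sym2.mem_mk_right x y, h.symm⟩⟩
    · exact ⟨a, fun h => absurd h he⟩
  choose f hf using hex
  refine ⟨f, fun e he e' he' hff => ?_, fun e he => ⟨Finset.mem_erase.2
    ⟨(hf e he).2.ne.symm, hEA e he _ (hf e he).1⟩, hf e he⟩⟩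
  by_contra hne
  obtain ⟨hve, hs⟩ := hf e he
  obtain ⟨hve', hs'⟩ := hf e' he'
  rw [← hff] at hve' hs'
  have hav := hA a ha _ (hEA e he _ hve)
  generalize f e = v at hve hs hve' hs' hav
  obtain ⟨x, rfl⟩ := hve
  obtain ⟨x', rfl⟩ := hve'
  -- The near part of `vx` does not contain `v`, so it also avoids the edge `vx'`.
  have hax : (S.deleteEdges {s(v, x')}).Reachable a x :=
    (reachable_deleteEdges_of_not_reachable ((reachable_deleteEdges_or hav x).resolve_left hs)
      hs).mono (deleteEdges_mono (deleteEdges_le _))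
  have hxv : (S.deleteEdges {s(v, x')}).Adj x v :=
    (deleteEdges_adj.2 ⟨(mem_bridges.1 (hE he)).1, hne⟩ : (S.deleteEdges {s(v, x')}).Adj v x).symm
  exact hs' (hax.trans hxv.reachable)

lemma card_bridges_lt (hE : E ⊆ bridges S) (hEA : ∀ e ∈ E, ∀ v ∈ e, v ∈ A) (hA : ConnectedOn S A)
    (hne : A.Nonempty) : E.card < A.card := by
  classical
  obtain ⟨a, ha⟩ := hne
  obtain ⟨f, hinj, hf⟩ := exists_far_injOn hE hEA hA ha
  calc E.card ≤ (A.erase a).card := Finset.card_le_card_of_injOn f (fun e he => (hf e he).1) hinj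
    _ < A.card := Finset.card_erase_lt_of_mem ha

lemma exists_far_of_card_le (hE : E ⊆ bridges S) (hEA : ∀ e ∈ E, ∀ v ∈ e, v ∈ A)
    (hA : ConnectedOn S A) (hcard : A.card ≤ E.card + 1) (ha : a ∈ A) (hb : b ∈ A) (hab : a ≠ b) :
    ∃ e ∈ E, b ∈ e ∧ Separates S e a b := by
  classical
  obtain ⟨f, hinj, hf⟩ := exists_far_injOn hE hEA hA ha
  obtain ⟨e, he, rfl⟩ := Finset.surjOn_of_injOn_of_card_le f (t := A.erase a)
    (fun e he => (hf e he).1) hinj (by rw [Finset.card_erase_of_mem ha]; omega)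
    (Finset.mem_erase.2 ⟨hab.symm, hb⟩)
  exact ⟨e, he, (hf e he).2⟩

lemma exists_two_separating (hE : E ⊆ bridges S) (hEA : ∀ e ∈ E, ∀ v ∈ e, v ∈ A)
    (hA : ConnectedOn S A) (hcard : A.card ≤ E.card + 1) (ha : a ∈ A) (hb : b ∈ A) (hab : a ≠ b)
    (hnadj : ¬ S.Adj a b) :
    ∃ e ∈ E, ∃ e' ∈ E, e ≠ e' ∧ Separates S e a b ∧ Separates S e' a b := by
  obtain ⟨e, he, hbe, hs⟩ := exists_far_of_card_le hE hEA hA hcard ha hb hab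
  obtain ⟨e', he', hae, hs'⟩ := exists_far_of_card_le hE hEA hA hcard hb ha hab.symm
  refine ⟨e, he, e', he', ?_, hs, hs'.symm⟩
  rintro rfl
  obtain rfl : e = s(a, b) := (Sym2.mem_and_mem_iff hab).1 ⟨hae, hbe⟩
  exact hnadj (mem_bridges.1 (hE he)).1

end Bridges

section NumEdges

variable {V : Type*} {H K : SimpleGraph V}

lemma numEdges_sup_le (H K : SimpleGraph V) : numEdges (H ⊔ K) ≤ numEdges H + numEdges K := by
  rw [numEdges, edgeSet_sup]
  exact Set.ncard_union_le _ _

variable [Finite V]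

lemma numEdges_mono (h : H ≤ K) : numEdges H ≤ numEdges K :=
  Set.ncard_le_ncard (edgeSet_mono h) (Set.toFinite _)

lemma numEdges_fromEdgeSet_le (s : Set (Sym2 V)) : numEdges (fromEdgeSet s) ≤ s.ncard := by
  rw [numEdges, edgeSet_fromEdgeSet]
  exact Set.ncard_le_ncard Set.sdiff_subset (Set.toFinite _)

lemma card_le_numEdges_add_one {A : Finset V} (hA : ConnectedOn H A) :
    A.card ≤ numEdges H + 1 := by
  rcases A.eq_empty_or_nonempty with rfl | ⟨a, ha⟩
  · exact Nat.zero_le _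
  let C := H.connectedComponentMk a
  have hsub : (A : Set V) ⊆ C.supp := fun v hv => ConnectedComponent.sound (hA v hv a ha)
  calc A.card = (A : Set V).ncard := (Set.ncard_coe_finset A).symm
    _ ≤ C.supp.ncard := Set.ncard_le_ncard hsub (Set.toFinite _)
    _ ≤ Nat.card C.toSimpleGraph.edgeSet + 1 :=
      C.connected_toSimpleGraph.card_vert_le_card_edgeSet_add_one
    _ ≤ numEdges H + 1 := Nat.add_le_add_right (Nat.card_le_card_of_injective _
      (Embedding.mapEdgeSet (Embedding.induce C.supp)).injective) 1

end NumEdges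

/-! ### Ears -/

section Ears

variable {V : Type*} {G S H : SimpleGraph V} {U T : Finset V}

/-- An ear of `G` on the vertex set `U`: a path outside `U`, its `inner` part, together with edges
from its two ends to vertices `a` and `b` of `U`. The case `a = b` of a cycle is allowed. -/
structure Ear (G : SimpleGraph V) (U : Finset V) where
  a : V
  b : V
  first : V
  last : V
  path : G.Walk first last
  isPath : path.IsPath
  a_mem : a ∈ U
  b_mem : b ∈ U
  adj_first : G.Adj a first
  adj_last : G.Adj last b
  notMem_of_mem_path : ∀ y ∈ path.support, y ∉ U
  first_ne_last : a = b → first ≠ last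

namespace Ear

/-- The walk along the whole ear. -/
def walk (E : Ear G U) : G.Walk E.a E.b := .cons E.adj_first (E.path.concat E.adj_last)

/-- The ear traversed in the opposite direction. -/
def reverse (E : Ear G U) : Ear G U where
  a := E.b
  b := E.a
  first := E.last
  last := E.first
  path := E.path.reverse
  isPath := E.isPath.reverse
  a_mem := E.b_mem
  b_mem := E.a_mem
  adj_first := E.adj_last.symm
  adj_last := E.adj_first.symm
  notMem_of_mem_path y hy := E.notMem_of_mem_path y (by simpa using hy)
  first_ne_last h := (E.first_ne_last h.symm).symm

variable (E : Ear G U)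

lemma edges_walk : E.walk.edges = s(E.a, E.first) :: (E.path.edges ++ [s(E.last, E.b)]) := by
  simp [walk, Walk.edges_concat]

lemma isTrail_walk : E.walk.IsTrail := by
  have ha : ∀ t, s(E.a, t) ∉ E.path.edges := fun t ht =>
    E.notMem_of_mem_path _ (E.path.fst_mem_support_of_mem_edges ht) E.a_mem
  have hb : ∀ t, s(t, E.b) ∉ E.path.edges := fun t ht =>
    E.notMem_of_mem_path _ (E.path.snd_mem_support_of_mem_edges ht) E.b_mem
  rw [Walk.isTrail_def, edges_walk, List.nodup_cons, ← List.concat_eq_append, List.nodup_concat]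
  refine ⟨fun h => ?_, hb _, E.isPath.isTrail.edges_nodup⟩
  rw [List.concat_eq_append, List.mem_append, List.mem_singleton] at h
  rcases Sym2.eq_iff.1 (h.resolve_left (ha _)) with ⟨h, -⟩ | ⟨h1, h2⟩
  · exact E.notMem_of_mem_path _ E.path.end_mem_support (h ▸ E.a_mem)
  · exact E.first_ne_last h1 h2

variable [DecidableEq V]

/-- The vertices of an ear outside the set to which it is attached. -/
def inner (E : Ear G U) : Finset V := E.path.support.toFinset

/-- The ear, attached to a larger set of vertices that still avoids its inner part. -/
def enlarge (hUT : U ⊆ T) (hT : Disjoint T E.inner) : Ear G T where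
  __ := E
  a_mem := hUT E.a_mem
  b_mem := hUT E.b_mem
  notMem_of_mem_path _ hy := Finset.disjoint_right.1 hT (List.mem_toFinset.2 hy)

lemma mem_inner {y : V} : y ∈ E.inner ↔ y ∈ E.path.support := List.mem_toFinset

lemma first_mem_inner : E.first ∈ E.inner := E.mem_inner.2 E.path.start_mem_support

lemma last_mem_inner : E.last ∈ E.inner := E.mem_inner.2 E.path.end_mem_support

lemma disjoint_inner : Disjoint U E.inner :=
  Finset.disjoint_right.2 fun y hy => E.notMem_of_mem_path y (E.mem_inner.1 hy)

lemma inner_reverse : E.reverse.inner = E.inner := by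
  ext y
  rw [mem_inner, mem_inner]
  exact (congrArg (y ∈ ·) (Walk.support_reverse E.path)).to_iff.trans List.mem_reverse

lemma mem_support_walk {y : V} : y ∈ E.walk.support ↔ y = E.a ∨ y ∈ E.inner ∨ y = E.b := by
  simp [walk, mem_inner, Walk.support_concat]

lemma exists_mem_inner_of_mem_edges {e : Sym2 V} (he : e ∈ E.walk.edges) :
    ∃ v ∈ e, v ∈ E.inner := by
  rw [edges_walk, List.mem_cons, List.mem_append, List.mem_singleton] at he
  rcases he with rfl | he | rfl
  · exact ⟨_, Sym2.mem_mk_right _ _, E.first_mem_inner⟩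
  · induction e with
    | _ x y =>
      exact ⟨x, Sym2.mem_mk_left x y, E.mem_inner.2 (E.path.fst_mem_support_of_mem_edges he)⟩
  · exact ⟨_, Sym2.mem_mk_left _ _, E.last_mem_inner⟩

end Ear

lemma exists_ear (hG : G.IsEdgeConnected 2) (hT : T.Nonempty) (hne : ∃ w, w ∉ T) :
    Nonempty (Ear G T) := by
  obtain ⟨t₀, ht₀⟩ := hT
  obtain ⟨w, hw⟩ := hne
  obtain ⟨p⟩ := hG.preconnected two_ne_zero w t₀
  obtain ⟨v, t, ht, hvt, q₀, -, hq₀⟩ :=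
    exists_isPath_outside p (T := T) (by simpa using hw) (by simpa using ht₀)
  obtain ⟨p'⟩ := isEdgeConnected_two.1 hG s(t, v) v t
  obtain ⟨v', t', ht', hvt', q, hq, hqT⟩ :=
    exists_isPath_outside p' (T := T) (hq₀ v q₀.end_mem_support).1 ht
  exact ⟨{
    a := t, b := t', first := v, last := v'
    path := q.mapLe (deleteEdges_le _)
    isPath := (Walk.isPath_mapLe _).2 hq
    a_mem := ht, b_mem := ht'
    adj_first := hvt.symm
    adj_last := deleteEdges_le _ hvt'
    notMem_of_mem_path := fun y hy => (hqT y (by rwa [Walk.support_mapLe_eq_support] at hy)).1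
    first_ne_last := by
      rintro rfl rfl
      exact (deleteEdges_adj.1 hvt').2 Sym2.eq_swap }⟩

/-- The graph `H` together with the edges of an ear. -/
def addEar (H : SimpleGraph V) (E : Ear G T) : SimpleGraph V :=
  H ⊔ fromEdgeSet {e | e ∈ E.walk.edges}

lemma le_addEar (H : SimpleGraph V) (E : Ear G T) : H ≤ addEar H E := le_sup_left

lemma mem_edgeSet_addEar {E : Ear G T} {e : Sym2 V} :
    e ∈ (addEar H E).edgeSet ↔ e ∈ H.edgeSet ∨ e ∈ E.walk.edges := by
  rw [addEar, edgeSet_sup, edgeSet_fromEdgeSet, Set.mem_union]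
  exact or_congr_right ⟨fun h => h.1,
    fun h => ⟨h, G.not_isDiag_of_mem_edgeSet (E.walk.edges_subset_edgeSet h)⟩⟩

lemma isPath_append {u v w : V} {p : G.Walk u v} {q : G.Walk v w} (hp : p.IsPath) (hq : q.IsPath)
    (h : ∀ t ∈ p.support, t ∈ q.support → t = v) : (p.append q).IsPath := by
  have hv : v ∉ q.support.tail := by
    have hnd := hq.support_nodup
    rw [← Walk.cons_tail_support, List.nodup_cons] at hnd
    exact hnd.1
  rw [Walk.isPath_def, Walk.support_append, List.nodup_append]
  refine ⟨hp.support_nodup, hq.support_nodup.tail, ?_⟩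
  rintro t ht _ ht' rfl
  exact hv (h t ht (List.mem_of_mem_tail ht') ▸ ht')

lemma reachable_deleteEdges_addEar {E : Ear G T} (hT : H.support ⊆ T) {e : Sym2 V}
    (he : e ∈ H.edgeSet) : ((addEar H E).deleteEdges {e}).Reachable E.a E.b := by
  classical
  let p : (addEar H E).Walk E.a E.b :=
    E.walk.transfer _ fun e he => mem_edgeSet_addEar.2 (Or.inr he)
  refine (p.toDeleteEdge e fun hep => ?_).reachable
  obtain ⟨v, hve, hv⟩ := E.exists_mem_inner_of_mem_edges ((Walk.edges_transfer _ _) ▸ hep)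
  obtain ⟨w, rfl⟩ := hve
  exact Finset.disjoint_right.1 E.disjoint_inner hv (hT (Adj.mem_support_left he))

lemma isEdgeReachable_two_of_mem_ear {E : Ear G T} (hT : H.support ⊆ T)
    (hab : H.Reachable E.a E.b) {x y : V} (hx : x ∈ E.walk.support) (hy : y ∈ E.walk.support) :
    (addEar H E).IsEdgeReachable 2 x y := by
  have hmem : ∀ e ∈ E.walk.edges, e ∈ (addEar H E).edgeSet :=
    fun e he => mem_edgeSet_addEar.2 (Or.inr he)
  have hends : (addEar H E).IsEdgeReachable 2 E.a E.b := isEdgeReachable_two.2 fun e => by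
    by_cases he : e ∈ H.edgeSet
    · exact reachable_deleteEdges_addEar hT he
    · exact hab.mono (le_deleteEdges_singleton (le_addEar H E) he)
  have htrail : (E.walk.transfer _ hmem).IsTrail := by
    rw [Walk.isTrail_def, Walk.edges_transfer]
    exact E.isTrail_walk.edges_nodup
  exact htrail.isEdgeReachable_two_of_isEdgeReachable_two hends
    (by rwa [Walk.support_transfer]) (by rwa [Walk.support_transfer])

/-- `H` is a connected subgraph of `G` on the vertices `T` that contains `S` and has no bridges
apart from bridges of `S`. -/
structure IsExtension [Finite V] (G S H : SimpleGraph V) (T : Finset V) : Prop where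
  le : H ≤ G
  base_le : S ≤ H
  support_subset : H.support ⊆ T
  connectedOn : ConnectedOn H T
  bridges_subset : bridges H ⊆ bridges S

variable [DecidableEq V]

lemma numEdges_addEar_le [Finite V] (H : SimpleGraph V) (E : Ear G T) :
    numEdges (addEar H E) ≤ numEdges H + (E.inner.card + 1) := by
  have hinner : E.inner.card = E.path.length + 1 := by
    rw [Ear.inner, List.toFinset_card_of_nodup E.isPath.support_nodup, Walk.length_support]
  have hwalk : {e | e ∈ E.walk.edges}.ncard ≤ E.inner.card + 1 := by
    rw [← List.coe_toFinset, Set.ncard_coe_finset]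
    refine (List.toFinset_card_le _).trans_eq ?_
    rw [Walk.length_edges, hinner, Ear.walk, Walk.length_cons, Walk.length_concat]
  exact (numEdges_sup_le _ _).trans
    (Nat.add_le_add_left ((numEdges_fromEdgeSet_le _).trans hwalk) _)

lemma IsExtension.addEar [Finite V] (h : IsExtension G S H T) (E : Ear G T) :
    IsExtension G S (addEar H E) (T ∪ E.inner) where
  le := sup_le h.le ((fromEdgeSet_le _).2 fun _ he => E.walk.edges_subset_edgeSet he.1)
  base_le := h.base_le.trans (le_addEar H E)
  support_subset u hu := by
    obtain ⟨v, huv⟩ := hu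
    rw [Finset.coe_union]
    rcases mem_edgeSet_addEar.1 (show s(u, v) ∈ _ from huv) with hH | hE
    · exact Or.inl (h.support_subset (Adj.mem_support_left hH))
    · rcases E.mem_support_walk.1 (E.walk.fst_mem_support_of_mem_edges hE) with rfl | hu | rfl
      exacts [Or.inl E.a_mem, Or.inr hu, Or.inl E.b_mem]
  connectedOn := by
    have ha : ∀ u ∈ T ∪ E.inner, (MonochromaticConnection.addEar H E).Reachable E.a u := by
      intro u hu
      rcases Finset.mem_union.1 hu with hu | hu
      · exact (h.connectedOn _ E.a_mem u hu).mono (le_addEar H E)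
      · exact (isEdgeReachable_two_of_mem_ear h.support_subset
          (h.connectedOn _ E.a_mem _ E.b_mem) E.walk.start_mem_support
          (E.mem_support_walk.2 (Or.inr (Or.inl hu)))).reachable two_ne_zero
    exact fun u hu v hv => (ha u hu).symm.trans (ha v hv)
  bridges_subset := by
    refine subset_trans (fun e he => ?_) h.bridges_subset
    obtain ⟨heE, hb⟩ := mem_bridges.1 he
    rcases mem_edgeSet_addEar.1 heE with hH | hE
    · exact mem_bridges.2 ⟨hH, hb.anti (le_addEar H E)⟩
    · induction e with
      | _ x y =>
        exact absurd (isEdgeReachable_two_of_mem_ear h.support_subset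
          (h.connectedOn _ E.a_mem _ E.b_mem) (E.walk.fst_mem_support_of_mem_edges hE)
          (E.walk.snd_mem_support_of_mem_edges hE)) hb.not_isEdgeReachable_two

lemma exists_ear_through_meeting_point {E E' : Ear G U} {y : V} (hy : y ∈ E.inner)
    (hy' : y ∈ E'.inner) (hne : E.a ≠ E'.b) :
    ∃ F : Ear G U, F.a = E.a ∧ F.b = E'.b ∧ F.inner ⊆ E.inner ∪ E'.inner ∧
      ∃ x ∈ F.inner, x ∈ E.inner ∧ x ∈ E'.inner := by
  obtain ⟨x, hx', hx, hfirst⟩ := E.path.exists_mem_support_forall_mem_support_imp_eq E'.inner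
    ⟨y, Finset.mem_filter.2 ⟨hy', E.mem_inner.1 hy⟩⟩
  have hx'' := E'.mem_inner.1 hx'
  have hsub : ∀ t ∈ ((E.path.takeUntil x hx).append (E'.path.dropUntil x hx'')).support,
      t ∈ E.inner ∨ t ∈ E'.inner := by
    intro t ht
    rw [Walk.mem_support_append_iff] at ht
    exact ht.imp (fun ht => E.mem_inner.2 (E.path.support_takeUntil_subset_support hx ht))
      (fun ht => E'.mem_inner.2 (E'.path.support_dropUntil_subset_support hx'' ht))
  refine ⟨{ a := E.a, b := E'.b, first := E.first, last := E'.last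
            path := (E.path.takeUntil x hx).append (E'.path.dropUntil x hx'')
            isPath := isPath_append (E.isPath.takeUntil hx) (E'.isPath.dropUntil hx'')
              fun t ht ht' => hfirst t
                (E'.mem_inner.2 (E'.path.support_dropUntil_subset_support hx'' ht')) ht
            a_mem := E.a_mem, b_mem := E'.b_mem
            adj_first := E.adj_first, adj_last := E'.adj_last
            notMem_of_mem_path := fun t ht => (hsub t ht).elim
              (Finset.disjoint_right.1 E.disjoint_inner ·)
              (Finset.disjoint_right.1 E'.disjoint_inner ·)
            first_ne_last := fun h => absurd h hne }, rfl, rfl, fun t ht => ?_, x, ?_,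
    E.mem_inner.2 hx, hx'⟩
  · exact Finset.mem_union.2 (hsub t (List.mem_toFinset.1 ht))
  · exact List.mem_toFinset.2
      ((Walk.mem_support_append_iff _ _).2 (Or.inl (Walk.end_mem_support _)))

lemma exists_ear_joining {E E' : Ear G U} {y c d : V} (hy : y ∈ E.inner) (hy' : y ∈ E'.inner)
    (hc : c ∈ ({E.a, E.b} : Set V)) (hd : d ∈ ({E'.a, E'.b} : Set V)) (hcd : c ≠ d) :
    ∃ F : Ear G U, F.a = c ∧ F.b = d ∧ F.inner ⊆ E.inner ∪ E'.inner ∧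
      ∃ x ∈ F.inner, x ∈ E.inner ∧ x ∈ E'.inner := by
  obtain ⟨E₁, rfl, h₁⟩ : ∃ E₁ : Ear G U, E₁.a = c ∧ E₁.inner = E.inner := by
    rcases hc with rfl | rfl
    exacts [⟨E, rfl, rfl⟩, ⟨E.reverse, rfl, E.inner_reverse⟩]
  obtain ⟨E₂, rfl, h₂⟩ : ∃ E₂ : Ear G U, E₂.b = d ∧ E₂.inner = E'.inner := by
    rcases hd with rfl | rfl
    exacts [⟨E'.reverse, rfl, E'.inner_reverse⟩, ⟨E', rfl, rfl⟩]
  rw [← h₁] at hy ⊢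
  rw [← h₂] at hy' ⊢
  exact exists_ear_through_meeting_point hy hy' hcd

end Ears

/-! ### Attaching ears within a budget -/

section BridgingEars

open scoped Classical

variable {V κ : Type*} {G S H H₀ : SimpleGraph V} {U T : Finset V}

/-- An ear whose two ends are separated in `S` by a distinguished edge `edge`. -/
structure BridgingEar (G S : SimpleGraph V) (U : Finset V) extends Ear G U where
  edge : Sym2 V
  separates : Separates S edge a b

lemma BridgingEar.not_separates_addEar [Finite V] (B : BridgingEar G S U)
    (h : IsExtension G S H T) (hS : ConnectedOn S U) {A : Ear G T} (ha : A.a ∈ U) (hb : A.b ∈ U)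
    (hs : Separates S B.edge A.a A.b) : ¬ Separates (addEar H A) B.edge B.a B.b := by
  have hedge : B.edge ∈ H.edgeSet :=
    edgeSet_mono h.base_le (B.separates.mem_edgeSet (hS _ B.a_mem _ B.b_mem))
  exact not_not.2 (reachable_deleteEdges_of_separates (h.base_le.trans (le_addEar H A))
    (hS _ ha _ B.a_mem) (hS _ ha _ B.b_mem) (hS _ ha _ hb) hs
    (reachable_deleteEdges_addEar h.support_subset hedge))

lemma Ear.ssubset_union_inner (A : Ear G T) : T ⊂ T ∪ A.inner :=
  Finset.ssubset_iff_subset_ne.2 ⟨Finset.subset_union_left, fun h =>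
    Finset.disjoint_right.1 A.disjoint_inner A.first_mem_inner
      (h.ge (Finset.mem_union_right T A.first_mem_inner))⟩

lemma card_biUnion_sdiff_pair_le {W : Finset V} {N : V → Finset κ} {k k' : κ} {x : V}
    (hkk' : k ≠ k') (hx : x ∈ W) (hk : k ∈ N x) (hk' : k' ∈ N x)
    (hN : ∀ w ∈ W, k ∈ N w ∨ k' ∈ N w) :
    W.card + 1 + (W.biUnion fun w => N w \ {k, k'}).card ≤ ∑ w ∈ W, (N w).card := by
  have hone : ∀ w ∈ W, 1 ≤ (N w ∩ {k, k'}).card := fun w hw => Finset.card_pos.2 <|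
    (hN w hw).elim (fun h => ⟨k, by simp [h]⟩) (fun h => ⟨k', by simp [h]⟩)
  have htwo : 1 < (N x ∩ {k, k'}).card :=
    Finset.one_lt_card.2 ⟨k, by simp [hk], k', by simp [hk'], hkk'⟩
  have hsum : W.card < ∑ w ∈ W, (N w ∩ {k, k'}).card := by
    simpa using Finset.sum_lt_sum hone ⟨x, hx, htwo⟩
  calc W.card + 1 + (W.biUnion fun w => N w \ {k, k'}).card
      ≤ ∑ w ∈ W, (N w ∩ {k, k'}).card + ∑ w ∈ W, (N w \ {k, k'}).card :=
        Nat.add_le_add hsum Finset.card_biUnion_le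
    _ = ∑ w ∈ W, (N w).card := by
        rw [← Finset.sum_add_distrib]
        exact Finset.sum_congr rfl fun w _ => Finset.card_inter_add_card_sdiff _ _

variable [Fintype κ] (E : κ → BridgingEar G S U)

/-- The ears of the family `E` whose inner part meets `T`. -/
noncomputable def touching (T : Finset V) : Finset κ := {k | ¬ Disjoint (E k).inner T}

/-- The ears of the family `E` whose ends are still separated in `H` by their edge. -/
noncomputable def pending (H : SimpleGraph V) : Finset κ :=
  {k | Separates H (E k).edge (E k).a (E k).b}

/-- The number of edges that a vertex pays for: one for each ear through it, and at least two. -/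
noncomputable def weight (z : V) : ℕ := max 2 (touching E {z}).card

variable {E}

lemma mem_touching {k : κ} : k ∈ touching E T ↔ ∃ z ∈ T, z ∈ (E k).inner := by
  simp [touching, Finset.not_disjoint_iff, and_comm]

lemma disjoint_inner_of_notMem_touching {k : κ} (hk : k ∉ touching E T) :
    Disjoint T (E k).inner :=
  Finset.disjoint_left.2 fun z hz hzk => hk (mem_touching.2 ⟨z, hz, hzk⟩)

lemma mem_pending {k : κ} : k ∈ pending E H ↔ Separates H (E k).edge (E k).a (E k).b := by
  simp [pending]

lemma pending_anti (hle : H₀ ≤ H) : pending E H ⊆ pending E H₀ := fun _ hk =>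
  mem_pending.2 fun hr => mem_pending.1 hk (hr.mono (deleteEdges_mono hle))

lemma card_add_one_le_sum_weight {W : Finset V} (hW : W.Nonempty) :
    W.card + 1 ≤ ∑ z ∈ W, weight E z := by
  have hsum : W.card * 2 ≤ ∑ z ∈ W, weight E z :=
    Finset.card_nsmul_le_sum _ (weight E) _ fun z _ => le_max_left _ _
  have := hW.card_pos
  omega

variable [Finite V]

variable (E) in
/-- `H` extends `S` to `T` and contains `H₀`, and its further edges are paid for by the weights of
the new vertices, with one edge left over for each pending ear that meets `T`. -/
structure IsAffordable (H₀ H : SimpleGraph V) (T : Finset V) : Prop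
    extends IsExtension G S H T where
  start_le : H₀ ≤ H
  subset : U ⊆ T
  budget : numEdges H + (pending E H ∩ touching E T).card ≤ numEdges H₀ + ∑ z ∈ T \ U, weight E z

lemma IsAffordable.addEar (h : IsAffordable E H₀ H T) (A : Ear G T) {F : Finset κ}
    (hF : ∀ k ∈ pending E (addEar H A), k ∈ touching E A.inner → k ∉ touching E T → k ∈ F)
    (hn : A.inner.card + 1 + F.card ≤ ∑ z ∈ A.inner, weight E z) :
    IsAffordable E H₀ (MonochromaticConnection.addEar H A) (T ∪ A.inner) where
  toIsExtension := h.toIsExtension.addEar A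
  start_le := h.start_le.trans (le_addEar H A)
  subset := h.subset.trans Finset.subset_union_left
  budget := by
    have hsum : ∑ z ∈ (T ∪ A.inner) \ U, weight E z =
        ∑ z ∈ T \ U, weight E z + ∑ z ∈ A.inner, weight E z := by
      rw [Finset.union_sdiff_distrib,
        Finset.sdiff_eq_self_of_disjoint (A.disjoint_inner.mono_left h.subset).symm,
        Finset.sum_union (A.disjoint_inner.mono_left Finset.sdiff_subset)]
    have hsub : pending E (MonochromaticConnection.addEar H A) ∩ touching E (T ∪ A.inner) ⊆
        pending E H ∩ touching E T ∪ F := by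
      intro k hk
      obtain ⟨hkp, hkt⟩ := Finset.mem_inter.1 hk
      by_cases hkT : k ∈ touching E T
      · exact Finset.mem_union_left _ (Finset.mem_inter.2 ⟨pending_anti (le_addEar H A) hkp, hkT⟩)
      · obtain ⟨z, hz, hzk⟩ := mem_touching.1 hkt
        have hzA : z ∈ A.inner := (Finset.mem_union.1 hz).resolve_left fun hzT =>
          hkT (mem_touching.2 ⟨z, hzT, hzk⟩)
        exact Finset.mem_union_right _ (hF k hkp (mem_touching.2 ⟨z, hzA, hzk⟩) hkT)
    have hcard := (Finset.card_le_card hsub).trans (Finset.card_union_le _ _)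
    have hnum := numEdges_addEar_le H A
    have hbudget := h.budget
    omega

lemma IsAffordable.exists_larger_of_meeting (h : IsAffordable E H₀ H T) (hS : ConnectedOn S U)
    {k k' : κ} {y : V} (hkk' : k ≠ k') (hk : k ∉ touching E T) (hk' : k' ∉ touching E T)
    (hy : y ∈ (E k).inner) (hy' : y ∈ (E k').inner) :
    ∃ H' T', T ⊂ T' ∧ IsAffordable E H₀ H' T' := by
  obtain ⟨c, hc, d, hd, hs, hs'⟩ := exists_separated_by_both (E k).separates (E k').separates
  obtain ⟨B, rfl, rfl, hB, x, hxB, hx, hx'⟩ := exists_ear_joining hy hy' hc hd hs.ne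
  let A : Ear G T := B.enlarge h.subset <| ((Finset.disjoint_union_right.2
    ⟨disjoint_inner_of_notMem_touching hk, disjoint_inner_of_notMem_touching hk'⟩).mono_right hB)
  let N : V → Finset κ := fun w => touching E {w}
  have hN : ∀ {i w}, i ∈ N w ↔ w ∈ (E i).inner := by simp [N, mem_touching]
  refine ⟨_, _, A.ssubset_union_inner,
    h.addEar A (F := A.inner.biUnion fun w => N w \ {k, k'}) (fun i hi hiA _ => ?_) ?_⟩
  · obtain ⟨w, hw, hwi⟩ := mem_touching.1 hiA
    have hclosed : ∀ j, Separates S (E j).edge A.a A.b → i ≠ j := by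
      rintro j hj rfl
      exact (E i).not_separates_addEar h.toIsExtension hS B.a_mem B.b_mem hj (mem_pending.1 hi)
    refine Finset.mem_biUnion.2 ⟨w, hw, Finset.mem_sdiff.2 ⟨hN.2 hwi, ?_⟩⟩
    simp only [Finset.mem_insert, Finset.mem_singleton, not_or]
    exact ⟨hclosed k hs, hclosed k' hs'⟩
  · refine (card_biUnion_sdiff_pair_le hkk' hxB (hN.2 hx) (hN.2 hx') fun w hw => ?_).trans
      (Finset.sum_le_sum fun w _ => le_max_right _ _)
    exact (Finset.mem_union.1 (hB hw)).imp hN.2 hN.2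

lemma IsAffordable.exists_larger (h : IsAffordable E H₀ H T) (hG : G.IsEdgeConnected 2)
    (hU : U.Nonempty) (hS : ConnectedOn S U) (hT : ∃ w, w ∉ T) :
    ∃ H' T', T ⊂ T' ∧ IsAffordable E H₀ H' T' := by
  have attach : ∀ A : Ear G T,
      (∀ k ∈ pending E (MonochromaticConnection.addEar H A), k ∈ touching E A.inner →
        k ∈ touching E T) → ∃ H' T', T ⊂ T' ∧ IsAffordable E H₀ H' T' := fun A hA =>
    ⟨_, _, A.ssubset_union_inner, h.addEar A (F := ∅) (fun k hk hkA hkT => absurd (hA k hk hkA) hkT)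
      (card_add_one_le_sum_weight ⟨_, A.first_mem_inner⟩)⟩
  by_cases huntouched : ∃ k, k ∉ touching E T
  · obtain ⟨k, hk⟩ := huntouched
    by_cases hmeet : ∃ k', k ≠ k' ∧ k' ∉ touching E T ∧ ∃ y ∈ (E k).inner, y ∈ (E k').inner
    · obtain ⟨k', hkk', hk', y, hy, hy'⟩ := hmeet
      exact h.exists_larger_of_meeting hS hkk' hk hk' hy hy'
    · push Not at hmeet
      refine attach ((E k).enlarge h.subset (disjoint_inner_of_notMem_touching hk))
        fun i hi hik => by_contra fun hiT => ?_
      obtain ⟨y, hy, hyi⟩ := mem_touching.1 hik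
      by_cases hki : k = i
      · subst hki
        exact (E k).not_separates_addEar h.toIsExtension hS (E k).a_mem (E k).b_mem
          (E k).separates (mem_pending.1 hi)
      · exact hmeet i hki hiT y hy hyi
  · push Not at huntouched
    obtain ⟨A⟩ := exists_ear hG (hU.mono h.subset) hT
    exact attach A fun k _ _ => huntouched k

end BridgingEars

open scoped Classical in
theorem exists_spanning_extension {V κ : Type*} [Fintype V] [Fintype κ] {G S H₀ : SimpleGraph V}
    {U : Finset V} (E : κ → BridgingEar G S U) (hG : G.IsEdgeConnected 2) (hU : U.Nonempty)
    (hS : ConnectedOn S U) (h₀ : IsExtension G S H₀ U) :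
    ∃ H, IsExtension G S H Finset.univ ∧ H₀ ≤ H ∧
      numEdges H + (pending E H).card ≤ numEdges H₀ + ∑ z ∈ Uᶜ, weight E z := by
  have hstart : IsAffordable E H₀ H₀ U := by
    refine ⟨h₀, le_rfl, subset_rfl, ?_⟩
    have hempty : touching E U = ∅ := Finset.eq_empty_of_forall_notMem fun k hk => by
      obtain ⟨z, hz, hzk⟩ := mem_touching.1 hk
      exact Finset.disjoint_left.1 (E k).disjoint_inner hz hzk
    simp [hempty]
  obtain ⟨T, ⟨H, hH⟩, hmax⟩ :=
    (Set.toFinite {T | ∃ H, IsAffordable E H₀ H T}).exists_maximal ⟨U, H₀, hstart⟩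
  obtain rfl : T = Finset.univ := by
    by_contra hT
    obtain ⟨H', T', hTT', h'⟩ :=
      hH.exists_larger hG hU hS (by simpa [Finset.eq_univ_iff_forall] using hT)
    exact hTT'.not_subset (hmax ⟨H', h'⟩ hTT'.subset)
  refine ⟨H, hH.toIsExtension, hH.start_le, ?_⟩
  have hall : touching E Finset.univ = Finset.univ := Finset.eq_univ_iff_forall.2 fun k =>
    mem_touching.2 ⟨_, Finset.mem_univ _, (E k).first_mem_inner⟩
  simpa [hall, Finset.compl_eq_univ_sdiff] using hH.budget

section OneEdgePerBridge

variable {V : Type*} [Finite V] {G H : SimpleGraph V} {e : Sym2 V}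

lemma isEdgeConnected_two_of_bridges_eq_empty (hH : H.Preconnected) (hb : bridges H = ∅) :
    H.IsEdgeConnected 2 := by
  refine isEdgeConnected_two.2 fun e u v => ?_
  by_cases he : e ∈ H.edgeSet
  · refine reachable_deleteEdges_of_not_isBridge (fun hbe => ?_) (hH u v)
    exact Finset.notMem_empty e (hb ▸ mem_bridges.2 ⟨he, hbe⟩)
  · exact (hH u v).mono (le_deleteEdges_singleton le_rfl he)

lemma exists_edge_destroying_bridge (hG : G.IsEdgeConnected 2) (hH : H.Preconnected)
    (he : e ∈ bridges H) : ∃ f ∈ G.edgeSet, bridges (H ⊔ fromEdgeSet {f}) ⊂ bridges H := by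
  classical
  induction e with
  | _ x y =>
  obtain ⟨p⟩ := isEdgeConnected_two.1 hG s(x, y) x y
  obtain ⟨⟨⟨z, t⟩, hzt⟩, -, hz, ht⟩ := p.exists_boundary_dart
    {v | (H.deleteEdges {s(x, y)}).Reachable x v} .rfl (mem_bridges.1 he).2
  have hyt : (H.deleteEdges {s(x, y)}).Reachable y t :=
    ((reachable_deleteEdges_three (hH x y) (hH x t) s(x, y)).resolve_left
      (mem_bridges.1 he).2).resolve_left ht
  obtain ⟨hztG, hne⟩ := deleteEdges_adj.1 hzt
  let H' := H ⊔ fromEdgeSet {s(z, t)}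
  have hle : H ≤ H' := le_sup_left
  have hcross : (H'.deleteEdges {s(x, y)}).Adj z t :=
    deleteEdges_adj.2 ⟨Or.inr ((fromEdgeSet_adj _).2 ⟨rfl, hztG.ne⟩), hne⟩
  have hnb : s(x, y) ∉ bridges H' := fun hb => (mem_bridges.1 hb).2
    (((hz.mono (deleteEdges_mono hle)).trans hcross.reachable).trans
      (hyt.symm.mono (deleteEdges_mono hle)))
  exact ⟨s(z, t), hztG, Finset.ssubset_iff_of_subset
    (bridges_subset_of_le hle fun u v _ => hH u v) |>.2 ⟨_, he, hnb⟩⟩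

theorem exists_isEdgeConnected_two_of_preconnected (hG : G.IsEdgeConnected 2) (hHG : H ≤ G)
    (hH : H.Preconnected) :
    ∃ H' ≤ G, H'.IsEdgeConnected 2 ∧ numEdges H' ≤ numEdges H + (bridges H).card := by
  induction hn : (bridges H).card using Nat.strong_induction_on generalizing H with
  | _ n ih =>
    rcases (bridges H).eq_empty_or_nonempty with hb | ⟨e, he⟩
    · exact ⟨H, hHG, isEdgeConnected_two_of_bridges_eq_empty hH hb, Nat.le_add_right _ _⟩
    · obtain ⟨f, hf, hlt⟩ := exists_edge_destroying_bridge hG hH he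
      have hcard := Finset.card_lt_card hlt
      have hle : H ⊔ fromEdgeSet {f} ≤ G :=
        sup_le hHG ((fromEdgeSet_le _).2 (Set.sdiff_subset.trans (by simpa using hf)))
      obtain ⟨H', hH'G, hH', hnum⟩ := ih _ (hn ▸ hcard) hle (hH.mono le_sup_left) rfl
      have hsup := numEdges_sup_le H (fromEdgeSet {f})
      have hone := numEdges_fromEdgeSet_le {f}
      rw [Set.ncard_singleton] at hone
      exact ⟨H', hH'G, hH', by omega⟩

end OneEdgePerBridge

/-! ### Class systems -/

section ClassSystem

open scoped Classical

variable {V ι : Type*} [Finite V] {G R : SimpleGraph V} {C : ι → SimpleGraph V} {U : Finset V}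
  {i s : ι} {u v z : V}

/-- The vertices that are not isolated in `R`. -/
noncomputable def supp (R : SimpleGraph V) : Finset V := (Set.toFinite R.support).toFinset

lemma mem_supp : v ∈ supp R ↔ ∃ w, R.Adj v w := by simp [supp, mem_support]

lemma mem_supp_of_reachable (h : R.Reachable u v) (huv : u ≠ v) : u ∈ supp R := by
  obtain ⟨p⟩ := h
  cases p with
  | nil => exact absurd rfl huv
  | cons h _ => exact mem_supp.2 ⟨_, h⟩

lemma mem_supp_of_mem_edgeSet {e : Sym2 V} (he : e ∈ R.edgeSet) (hv : v ∈ e) : v ∈ supp R := by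
  obtain ⟨w, rfl⟩ := hv
  exact mem_supp.2 ⟨w, he⟩

lemma numEdges_pos (h : (supp R).Nonempty) : 0 < numEdges R := by
  obtain ⟨u, hu⟩ := h
  obtain ⟨v, huv⟩ := mem_supp.1 hu
  exact (Set.ncard_pos (Set.toFinite _)).2 ⟨s(u, v), huv⟩

lemma card_supp_le_numEdges (hR : ConnectedOn R (supp R)) (huv : R.Adj u v)
    (h₂ : R.IsEdgeReachable 2 u v) : (supp R).card ≤ numEdges R := by
  have hnb : ¬ R.IsBridge s(u, v) := fun hb => hb.not_isEdgeReachable_two h₂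
  calc (supp R).card ≤ numEdges (R.deleteEdges {s(u, v)}) + 1 :=
        card_le_numEdges_add_one fun a ha b hb =>
          reachable_deleteEdges_of_not_isBridge hnb (hR a ha b hb)
    _ = numEdges R := by
        rw [numEdges, edgeSet_deleteEdges]
        exact Set.ncard_sdiff_singleton_add_one huv (Set.toFinite _)

/-- Edge-disjoint subgraphs of `G`, each connected on its support and nontrivial, such that any two
vertices are joined in two of them, or by two edge-disjoint paths in one of them. The components of
the color classes of an `MC_2`-coloring have this property. -/
structure IsClassSystem (G : SimpleGraph V) (C : ι → SimpleGraph V) : Prop where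
  le : ∀ i, C i ≤ G
  disjoint : ∀ ⦃i j u v⦄, (C i).Adj u v → (C j).Adj u v → i = j
  nonempty : ∀ i, (supp (C i)).Nonempty
  connectedOn : ∀ i, ConnectedOn (C i) (supp (C i))
  cover : ∀ u v, u ≠ v → ∃ i j, (C i).Reachable u v ∧ (C j).Reachable u v ∧
    (i = j → (C i).IsEdgeReachable 2 u v)

/-- The vertices of `U` that the class `i` meets. -/
noncomputable def trace (C : ι → SimpleGraph V) (U : Finset V) (i : ι) : Finset V :=
  supp (C i) ∩ U

lemma mem_trace : v ∈ trace C U i ↔ v ∈ supp (C i) ∧ v ∈ U := Finset.mem_inter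

lemma IsClassSystem.connectedOn_trace (h : IsClassSystem G C) (i : ι) :
    ConnectedOn (C s) (trace C (supp (C s)) i) := fun u hu v hv =>
  h.connectedOn s u (mem_trace.1 hu).2 v (mem_trace.1 hv).2

/-- A class pays for its vertices outside `U`, but not for one chosen neighbor of its only vertex
in `U` if it is a tree that meets `U` in one vertex. -/
structure IsPaidSet (R : SimpleGraph V) (U P : Finset V) : Prop where
  subset : P ⊆ supp R \ U
  card_le : ((supp R ∩ U).card - 2) + P.card ≤ numEdges R - 1
  mem_of_two_le : ∀ z ∈ supp R \ U, 2 ≤ (supp R ∩ U).card → z ∈ P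
  unpaid : ∀ z ∈ supp R \ U, z ∉ P → ∀ u ∈ supp R ∩ U, R.Adj u z ∧ numEdges R < (supp R).card

lemma exists_isPaidSet (hR : ConnectedOn R (supp R)) (hne : (supp R).Nonempty) (U : Finset V) :
    ∃ P, IsPaidSet R U P := by
  have hpos := numEdges_pos hne
  have hedges : (supp R).card ≤ numEdges R + 1 := card_le_numEdges_add_one hR
  have hsplit : (supp R \ U).card + (supp R ∩ U).card = (supp R).card :=
    Finset.card_sdiff_add_card_inter _ _
  by_cases hcard : (supp R ∩ U).card = 0
  · refine ⟨∅, Finset.empty_subset _, by simp [hcard], fun z _ h => by omega, fun z _ _ u hu => ?_⟩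
    exact absurd hu (Finset.card_eq_zero.1 hcard ▸ Finset.notMem_empty u)
  by_cases hall : 2 ≤ (supp R ∩ U).card ∨ (supp R).card ≤ numEdges R
  · exact ⟨supp R \ U, subset_rfl, by omega, fun z hz _ => hz, fun z hz hz' => absurd hz hz'⟩
  obtain ⟨u, hu⟩ := Finset.card_eq_one.1 (show (supp R ∩ U).card = 1 by omega)
  have huU : u ∈ supp R ∩ U := hu ▸ Finset.mem_singleton_self u
  obtain ⟨w, huw⟩ := mem_supp.1 (Finset.mem_inter.1 huU).1
  have hw : w ∈ supp R \ U := by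
    refine Finset.mem_sdiff.2 ⟨mem_supp.2 ⟨u, huw.symm⟩, fun hwU => huw.ne' ?_⟩
    exact Finset.mem_singleton.1 (hu ▸ Finset.mem_inter.2 ⟨mem_supp.2 ⟨u, huw.symm⟩, hwU⟩)
  refine ⟨(supp R \ U).erase w, Finset.erase_subset _ _, ?_, fun z _ h => by omega,
    fun z hz hzw u' hu' => ⟨?_, by omega⟩⟩
  · rw [Finset.card_erase_of_mem hw]
    omega
  · obtain rfl : z = w := by_contra fun h => hzw (Finset.mem_erase.2 ⟨h, hz⟩)
    obtain rfl : u' = u := Finset.mem_singleton.1 (hu ▸ hu')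
    exact huw

lemma IsClassSystem.exists_mem_paid (h : IsClassSystem G C) {P : ι → Finset V}
    (hP : ∀ i, IsPaidSet (C i) U (P i)) (hu : u ∈ U) (hz : z ∉ U) :
    ∃ i, z ∈ P i ∧ u ∈ supp (C i) := by
  have huz : u ≠ z := fun h => hz (h ▸ hu)
  have hmem : ∀ i, (C i).Reachable u z → u ∈ supp (C i) ∧ z ∈ supp (C i) := fun i hi =>
    ⟨mem_supp_of_reachable hi huz, mem_supp_of_reachable hi.symm huz.symm⟩
  have hunpaid : ∀ i, (C i).Reachable u z → z ∉ P i →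
      (C i).Adj u z ∧ numEdges (C i) < (supp (C i)).card := fun i hi hzi =>
    (hP i).unpaid z (Finset.mem_sdiff.2 ⟨(hmem i hi).2, hz⟩) hzi u
      (Finset.mem_inter.2 ⟨(hmem i hi).1, hu⟩)
  obtain ⟨i, j, hi, hj, hij⟩ := h.cover u z huz
  by_contra! hno
  obtain ⟨hadj, hlt⟩ := hunpaid i hi fun hzi => hno i hzi (hmem i hi).1
  obtain ⟨hadj', -⟩ := hunpaid j hj fun hzj => hno j hzj (hmem j hj).1
  exact absurd (card_supp_le_numEdges (h.connectedOn i) hadj (hij (h.disjoint hadj hadj')))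
    hlt.not_ge

variable [Fintype ι]

/-- The classes other than `s` through `z` that meet the class `s` in at least two vertices. -/
noncomputable def classesThrough (C : ι → SimpleGraph V) (s : ι) (z : V) : Finset ι :=
  {i | i ≠ s ∧ 2 ≤ (trace C (supp (C s)) i).card ∧ z ∈ supp (C i)}

lemma IsClassSystem.max_card_classesThrough_le (h : IsClassSystem G C)
    (hmax : ∀ i, (supp (C i)).card ≤ (supp (C s)).card) {P : ι → Finset V}
    (hP : ∀ i, IsPaidSet (C i) (supp (C s)) (P i)) (hz : z ∉ supp (C s)) :
    max 2 (classesThrough C s z).card ≤ ({i ∈ Finset.univ.erase s | z ∈ P i} : Finset ι).card := by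
  have hpaid : ∀ i, z ∈ P i → i ∈ ({i ∈ Finset.univ.erase s | z ∈ P i} : Finset ι) := by
    refine fun i hi => Finset.mem_filter.2 ⟨Finset.mem_erase.2 ⟨?_, Finset.mem_univ i⟩, hi⟩
    rintro rfl
    exact hz (Finset.mem_sdiff.1 ((hP i).subset hi)).1
  refine max_le ?_ (Finset.card_le_card fun i hi => ?_)
  · -- A single paying class would contain `z` and all of the largest class.
    by_contra! hlt
    obtain ⟨u₀, hu₀⟩ := h.nonempty s
    obtain ⟨i, hi, -⟩ := h.exists_mem_paid hP hu₀ hz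
    have hsub : insert z (supp (C s)) ⊆ supp (C i) := by
      refine Finset.insert_subset (Finset.mem_sdiff.1 ((hP i).subset hi)).1 fun u hu => ?_
      obtain ⟨j, hj, huj⟩ := h.exists_mem_paid hP hu hz
      rwa [Finset.card_le_one.1 (Nat.lt_succ_iff.1 hlt) i (hpaid i hi) j (hpaid j hj)]
    have hcard := Finset.card_le_card hsub
    rw [Finset.card_insert_of_notMem hz] at hcard
    exact absurd (hmax i) (by omega)
  · obtain ⟨-, -, htwo, hzi⟩ := Finset.mem_filter.1 hi
    exact hpaid i ((hP i).mem_of_two_le z (Finset.mem_sdiff.2 ⟨hzi, hz⟩) htwo)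

end ClassSystem

open scoped Classical in
theorem IsClassSystem.sum_le_sum_numEdges {V ι : Type*} [Fintype V] [Fintype ι] {G : SimpleGraph V}
    {C : ι → SimpleGraph V} {s : ι} (h : IsClassSystem G C)
    (hmax : ∀ i, (supp (C i)).card ≤ (supp (C s)).card) :
    ∑ i ∈ Finset.univ.erase s, ((trace C (supp (C s)) i).card - 2) +
      ∑ z ∈ (supp (C s))ᶜ, max 2 (classesThrough C s z).card ≤
      ∑ i ∈ Finset.univ.erase s, (numEdges (C i) - 1) := by
  choose P hP using fun i => exists_isPaidSet (h.connectedOn i) (h.nonempty i) (supp (C s))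
  have hfilter : ∀ i, ({z ∈ (supp (C s))ᶜ | z ∈ P i} : Finset V) = P i := fun i => by
    ext z
    have hz : z ∈ P i → z ∉ supp (C s) := fun hz => (Finset.mem_sdiff.1 ((hP i).subset hz)).2
    simpa using hz
  calc
    _ ≤ ∑ i ∈ Finset.univ.erase s, ((trace C (supp (C s)) i).card - 2) +
        ∑ z ∈ (supp (C s))ᶜ, ({i ∈ Finset.univ.erase s | z ∈ P i} : Finset ι).card :=
      Nat.add_le_add_left (Finset.sum_le_sum fun z hz =>
        h.max_card_classesThrough_le hmax hP (Finset.mem_compl.1 hz)) _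
    _ = ∑ i ∈ Finset.univ.erase s, (((trace C (supp (C s)) i).card - 2) + (P i).card) := by
      rw [Finset.sum_add_distrib,
        ← Finset.sum_congr rfl fun i _ => congrArg Finset.card (hfilter i)]
      exact congrArg _ (Finset.sum_card_bipartiteAbove_eq_sum_card_bipartiteBelow
        fun i z => z ∈ P i).symm
    _ ≤ _ := Finset.sum_le_sum fun i _ => (hP i).card_le

section BridgeCover

open scoped Classical

variable {V ι : Type*} [Finite V] {G S H : SimpleGraph V} {C : ι → SimpleGraph V} {s i : ι}
  {U : Finset V} {c d : V}

lemma notMem_bridges_of_separates {e : Sym2 V} (hS : ConnectedOn S (supp S)) (hle : S ≤ H)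
    (hc : c ∈ supp S) (hd : d ∈ supp S) (hs : Separates S e c d)
    (hr : (H.deleteEdges {e}).Reachable c d) : e ∉ bridges H := by
  have he : e ∈ S.edgeSet := hs.mem_edgeSet (hS c hc d hd)
  have hmem : ∀ v ∈ e, S.Reachable c v := fun v hv => hS c hc v (mem_supp_of_mem_edgeSet he hv)
  refine fun hb => ?_
  induction e with
  | _ x y =>
    exact (mem_bridges.1 hb).2 (reachable_deleteEdges_of_separates hle
      (hmem x (Sym2.mem_mk_left x y)) (hmem y (Sym2.mem_mk_right x y)) (hS c hc d hd) hs hr)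

/-- The graph `R` has an edge between two vertices of `U`. -/
def IsChordal (R : SimpleGraph V) (U : Finset V) : Prop :=
  ∃ a ∈ U, ∃ b ∈ U, R.Adj a b

/-- An assignment of the bridges of the class `s` to other classes containing both ends. -/
structure BridgeCover (C : ι → SimpleGraph V) (s : ι) where
  assign : Sym2 V → ι
  ne : ∀ e ∈ bridges (C s), assign e ≠ s
  mem_supp_assign : ∀ e ∈ bridges (C s), ∀ v ∈ e, v ∈ supp (C (assign e))

lemma IsClassSystem.nonempty_bridgeCover (h : IsClassSystem G C) (s : ι) :
    Nonempty (BridgeCover C s) := by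
  have hex : ∀ e : Sym2 V, ∃ i, e ∈ bridges (C s) → i ≠ s ∧ ∀ v ∈ e, v ∈ supp (C i) := by
    intro e
    by_cases he : e ∈ bridges (C s)
    · induction e with
      | _ x y =>
      obtain ⟨hxy, hb⟩ := mem_bridges.1 he
      have hne : x ≠ y := Adj.ne hxy
      have hends : ∀ i, (C i).Reachable x y → ∀ v ∈ s(x, y), v ∈ supp (C i) := by
        intro i hi v hv
        rcases Sym2.mem_iff.1 hv with rfl | rfl
        exacts [mem_supp_of_reachable hi hne, mem_supp_of_reachable hi.symm hne.symm]
      obtain ⟨i, j, hi, hj, hij⟩ := h.cover x y hne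
      by_cases his : i = s
      · subst his
        exact ⟨j, fun _ => ⟨fun hji => hb.not_isEdgeReachable_two (hij hji.symm), hends j hj⟩⟩
      · exact ⟨i, fun _ => ⟨his, hends i hi⟩⟩
    · exact ⟨s, fun h => absurd h he⟩
  choose f hf using hex
  exact ⟨⟨f, fun e he => (hf e he).1, fun e he => (hf e he).2⟩⟩

namespace BridgeCover

variable (τ : BridgeCover C s)

/-- The bridges of the class `s` assigned to the class `i`. -/
noncomputable def load (i : ι) : Finset (Sym2 V) := {e ∈ bridges (C s) | τ.assign e = i}

/-- The class `i` receives as many bridges as its trace on the class `s` can carry. -/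
def IsTight (i : ι) : Prop :=
  (τ.load i).Nonempty ∧ (trace C (supp (C s)) i).card ≤ (τ.load i).card + 1

variable {τ}

lemma load_subset : τ.load i ⊆ bridges (C s) := Finset.filter_subset _ _

lemma mem_trace_of_mem_load {e : Sym2 V} (he : e ∈ τ.load i) {v : V} (hv : v ∈ e) :
    v ∈ trace C (supp (C s)) i := by
  obtain ⟨heb, rfl⟩ := Finset.mem_filter.1 he
  exact mem_trace.2 ⟨τ.mem_supp_assign e heb v hv, mem_supp_of_mem_edgeSet (mem_bridges.1 heb).1 hv⟩

lemma ne_of_load_nonempty (h : (τ.load i).Nonempty) : i ≠ s := by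
  obtain ⟨e, he⟩ := h
  obtain ⟨heb, rfl⟩ := Finset.mem_filter.1 he
  exact τ.ne e heb

lemma card_load_lt (h : IsClassSystem G C) (hne : (τ.load i).Nonempty) :
    (τ.load i).card < (trace C (supp (C s)) i).card := by
  refine card_bridges_lt load_subset (fun _ he _ hv => mem_trace_of_mem_load he hv)
    (h.connectedOn_trace i) ?_
  obtain ⟨⟨x, y⟩, he⟩ := hne
  exact ⟨x, mem_trace_of_mem_load he (Sym2.mem_mk_left x y)⟩

lemma IsTight.two_le_card_trace (h : IsClassSystem G C) (ht : τ.IsTight i) :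
    2 ≤ (trace C (supp (C s)) i).card := by
  have := card_load_lt h ht.1
  have := ht.1.card_pos
  omega

lemma IsTight.exists_bridgingEar (h : IsClassSystem G C) (ht : τ.IsTight i)
    (hno : ¬ IsChordal (C i) (supp (C s))) :
    ∃ B : BridgingEar G (C s) (supp (C s)), B.edge ∈ τ.load i ∧ B.inner ⊆ supp (C i) := by
  obtain ⟨a, ha, b, hb, hab⟩ := Finset.one_lt_card.1 (ht.two_le_card_trace h)
  obtain ⟨hai, haU⟩ := mem_trace.1 ha
  obtain ⟨hbi, hbU⟩ := mem_trace.1 hb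
  obtain ⟨p⟩ := h.connectedOn i a hai b hbi
  obtain ⟨last, x, ⟨hxU, hxa⟩, hlast, q, hq, hqT⟩ :=
    exists_isPath_outside p (T := {v | v ∈ supp (C s) ∧ v ≠ a}) (fun h => h.2 rfl) ⟨hbU, hab.symm⟩
  obtain ⟨e, he, -, hsep⟩ := exists_far_of_card_le load_subset
    (fun _ he _ hv => mem_trace_of_mem_load he hv) (h.connectedOn_trace i) ht.2 ha
    (mem_trace.2 ⟨mem_supp.2 ⟨last, hlast.symm⟩, hxU⟩) (Ne.symm hxa)
  cases q with
  | nil => exact absurd ⟨a, haU, x, hxU, hlast⟩ hno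
  | @cons _ first _ hfirst q =>
    obtain ⟨hq, haq⟩ := (Walk.cons_isPath_iff _ _).1 hq
    have hqU : ∀ y ∈ q.support, y ∉ supp (C s) := fun y hy hyU =>
      (hqT y (List.mem_cons_of_mem _ hy)).1 ⟨hyU, fun hya => haq (hya ▸ hy)⟩
    refine ⟨⟨⟨a, x, first, last, q.mapLe (h.le i), (Walk.isPath_mapLe _).2 hq, haU, hxU,
      h.le i hfirst, h.le i hlast, by simpa only [Walk.support_mapLe_eq_support] using hqU,
      fun hax => absurd hax.symm hxa⟩, e, hsep⟩, he, fun y hy => ?_⟩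
    have hy' : y ∈ q.support := by
      simpa only [Ear.inner, List.mem_toFinset, Walk.support_mapLe_eq_support] using hy
    have hya : y ≠ a := fun hya => haq (hya ▸ hy')
    exact mem_supp_of_reachable
      ((q.takeUntil y hy').reachable.symm.trans hfirst.reachable.symm) hya

lemma card_inter_load_le_of_not_isTight {B : Finset (Sym2 V)} (ht : ¬ τ.IsTight i) :
    (B ∩ τ.load i).card ≤ (trace C (supp (C s)) i).card - 2 := by
  rcases (τ.load i).eq_empty_or_nonempty with hempty | hne
  · simp [hempty]
  · have := Finset.card_le_card (Finset.inter_subset_right (s₁ := B) (s₂ := τ.load i))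
    have : ¬ (trace C (supp (C s)) i).card ≤ (τ.load i).card + 1 := fun hle => ht ⟨hne, hle⟩
    omega

lemma IsTight.card_inter_load_le (h : IsClassSystem G C) (ht : τ.IsTight i) (hle : C s ≤ H)
    {e : Sym2 V} (he : e ∈ τ.load i) (hc : c ∈ supp (C s)) (hd : d ∈ supp (C s))
    (hs : Separates (C s) e c d) (hr : ¬ Separates H e c d) :
    (bridges H ∩ τ.load i).card ≤ (trace C (supp (C s)) i).card - 2 := by
  have hnb := notMem_bridges_of_separates (h.connectedOn s) hle hc hd hs (not_not.1 hr)
  have hsub : bridges H ∩ τ.load i ⊆ (τ.load i).erase e := fun f hf => by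
    obtain ⟨hfH, hfi⟩ := Finset.mem_inter.1 hf
    exact Finset.mem_erase.2 ⟨fun hfe => hnb (hfe ▸ hfH), hfi⟩
  have hcard := Finset.card_le_card hsub
  rw [Finset.card_erase_of_mem he] at hcard
  have := card_load_lt h ht.1
  omega

lemma IsTight.card_inter_load_add_one_le (h : IsClassSystem G C) (ht : τ.IsTight i)
    (hle : C s ≤ H) (hc : c ∈ supp (C s)) (hd : d ∈ supp (C s)) (hadj : (C i).Adj c d)
    (hH : H.Adj c d) :
    (bridges H ∩ τ.load i).card + 1 ≤ (trace C (supp (C s)) i).card - 2 := by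
  have hnadj : ¬ (C s).Adj c d := fun hcd => ne_of_load_nonempty ht.1 (h.disjoint hadj hcd)
  obtain ⟨e, he, e', he', hee', hs, hs'⟩ := exists_two_separating load_subset
    (fun _ he _ hv => mem_trace_of_mem_load he hv) (h.connectedOn_trace i) ht.2
    (mem_trace.2 ⟨mem_supp.2 ⟨d, hadj⟩, hc⟩) (mem_trace.2 ⟨mem_supp.2 ⟨c, hadj.symm⟩, hd⟩)
    hadj.ne hnadj
  have hnb : ∀ f ∈ τ.load i, Separates (C s) f c d → f ∉ bridges H := fun f hf hsf => by
    refine notMem_bridges_of_separates (h.connectedOn s) hle hc hd hsf (Adj.reachable ?_)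
    refine deleteEdges_adj.2 ⟨hH, fun hcd => hnadj ?_⟩
    rw [← mem_edgeSet, Set.mem_singleton_iff.1 hcd]
    exact (mem_bridges.1 (load_subset hf)).1
  have hsub : bridges H ∩ τ.load i ⊆ ((τ.load i).erase e).erase e' := fun f hf => by
    obtain ⟨hfH, hfi⟩ := Finset.mem_inter.1 hf
    exact Finset.mem_erase.2 ⟨fun hfe => hnb e' he' hs' (hfe ▸ hfH),
      Finset.mem_erase.2 ⟨fun hfe => hnb e he hs (hfe ▸ hfH), hfi⟩⟩
  have hcard := Finset.card_le_card hsub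
  rw [Finset.card_erase_of_mem (Finset.mem_erase.2 ⟨hee'.symm, he'⟩),
    Finset.card_erase_of_mem he] at hcard
  have : 1 < (τ.load i).card := Finset.one_lt_card.2 ⟨e, he, e', he', hee'⟩
  have := card_load_lt h ht.1
  omega

variable [Fintype ι]

variable (τ) in
/-- The tight classes with an edge between two vertices of the class `s`. -/
noncomputable def chordal : Finset ι := {i | τ.IsTight i ∧ IsChordal (C i) (supp (C s))}

lemma mem_chordal : i ∈ τ.chordal ↔ τ.IsTight i ∧ IsChordal (C i) (supp (C s)) := by
  simp [chordal]

lemma exists_isExtension (h : IsClassSystem G C) (τ : BridgeCover C s) :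
    ∃ H, IsExtension G (C s) H (supp (C s)) ∧ numEdges H ≤ numEdges (C s) + τ.chordal.card ∧
      ∀ i ∈ τ.chordal, ∃ a ∈ supp (C s), ∃ b ∈ supp (C s), (C i).Adj a b ∧ H.Adj a b := by
  have hex : ∀ i : τ.chordal, IsChordal (C i) (supp (C s)) := fun i => (mem_chordal.1 i.2).2
  choose a ha b hb hab using hex
  let K : SimpleGraph V := fromEdgeSet (Set.range fun i => s(a i, b i))
  have hK : ∀ ⦃u v⦄, K.Adj u v → G.Adj u v ∧ u ∈ supp (C s) ∧ v ∈ supp (C s) := fun u v huv => by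
    obtain ⟨⟨i, hi⟩, -⟩ := (fromEdgeSet_adj _).1 huv
    rcases Sym2.eq_iff.1 hi with ⟨rfl, rfl⟩ | ⟨rfl, rfl⟩
    exacts [⟨h.le _ (hab i), ha i, hb i⟩, ⟨(h.le _ (hab i)).symm, hb i, ha i⟩]
  have hsupp : ∀ ⦃u v⦄, (C s ⊔ K).Adj u v → u ∈ supp (C s) ∧ v ∈ supp (C s) := fun u v huv =>
    huv.elim (fun huv => ⟨mem_supp.2 ⟨v, huv⟩, mem_supp.2 ⟨u, huv.symm⟩⟩) fun huv => (hK huv).2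
  refine ⟨C s ⊔ K, ⟨sup_le (h.le s) fun _ _ huv => (hK huv).1, le_sup_left, ?_,
    (h.connectedOn s).mono le_sup_left, bridges_subset_of_le le_sup_left fun u v huv =>
      h.connectedOn s u (hsupp huv).1 v (hsupp huv).2⟩, ?_, fun i hi => ?_⟩
  · rintro u ⟨v, huv⟩
    exact (hsupp huv).1
  · refine (numEdges_sup_le _ _).trans (Nat.add_le_add_left ?_ _)
    calc numEdges K ≤ (Set.range fun i => s(a i, b i)).ncard := numEdges_fromEdgeSet_le _
      _ ≤ Nat.card τ.chordal := by
        rw [← Nat.card_coe_set_eq]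
        exact Finite.card_range_le _
      _ = τ.chordal.card := Nat.card_eq_finsetCard _
  · exact ⟨_, ha ⟨i, hi⟩, _, hb ⟨i, hi⟩, hab ⟨i, hi⟩,
      Or.inr ((fromEdgeSet_adj _).2 ⟨⟨⟨i, hi⟩, rfl⟩, (hab ⟨i, hi⟩).ne⟩)⟩

section Count

variable
  {E : {i // τ.IsTight i ∧ ¬ IsChordal (C i) (supp (C s))} → BridgingEar G (C s) (supp (C s))}

lemma card_inter_load_add_le (h : IsClassSystem G C) (hle : C s ≤ H)
    (hchord : ∀ i ∈ τ.chordal, ∃ a ∈ supp (C s), ∃ b ∈ supp (C s), (C i).Adj a b ∧ H.Adj a b)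
    (hE : ∀ k, (E k).edge ∈ τ.load k.1) (i : ι) :
    (bridges H ∩ τ.load i).card + (if i ∈ τ.chordal then 1 else 0) ≤
      ((trace C (supp (C s)) i).card - 2) +
        if i ∈ (pending E H).image Subtype.val then 1 else 0 := by
  by_cases ht : τ.IsTight i
  swap
  · rw [if_neg fun hi => ht (mem_chordal.1 hi).1]
    exact (card_inter_load_le_of_not_isTight ht).trans (Nat.le_add_right _ _)
  by_cases hi : i ∈ τ.chordal
  · obtain ⟨a, ha, b, hb, hab, hH⟩ := hchord i hi
    rw [if_pos hi]
    exact (ht.card_inter_load_add_one_le h hle ha hb hab hH).trans (Nat.le_add_right _ _)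
  rw [if_neg hi, add_zero]
  let k : {i // τ.IsTight i ∧ ¬ IsChordal (C i) (supp (C s))} :=
    ⟨i, ht, fun hc => hi (mem_chordal.2 ⟨ht, hc⟩)⟩
  by_cases hk : k ∈ pending E H
  · rw [if_pos (Finset.mem_image.2 ⟨k, hk, rfl⟩)]
    have := Finset.card_le_card (Finset.inter_subset_right (s₁ := bridges H) (s₂ := τ.load i))
    have := card_load_lt h ht.1
    omega
  · exact (ht.card_inter_load_le h hle (hE k) (E k).a_mem (E k).b_mem (E k).separates
      fun hs => hk (mem_pending.2 hs)).trans (Nat.le_add_right _ _)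

lemma card_bridges_add_card_chordal_le (h : IsClassSystem G C) (hle : C s ≤ H)
    (hbr : bridges H ⊆ bridges (C s))
    (hchord : ∀ i ∈ τ.chordal, ∃ a ∈ supp (C s), ∃ b ∈ supp (C s), (C i).Adj a b ∧ H.Adj a b)
    (hE : ∀ k, (E k).edge ∈ τ.load k.1) :
    (bridges H).card + τ.chordal.card ≤
      ∑ i ∈ Finset.univ.erase s, ((trace C (supp (C s)) i).card - 2) + (pending E H).card := by
  have hbridges : (bridges H).card = ∑ i ∈ Finset.univ.erase s, (bridges H ∩ τ.load i).card := by
    rw [Finset.card_eq_sum_card_fiberwise (f := τ.assign) (t := Finset.univ.erase s) fun e he =>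
      Finset.mem_erase.2 ⟨τ.ne e (hbr he), Finset.mem_univ _⟩]
    refine Finset.sum_congr rfl fun i _ => congrArg Finset.card ?_
    rw [load, Finset.inter_filter, Finset.inter_eq_left.2 hbr]
  have hchordal : τ.chordal.card = ∑ i ∈ Finset.univ.erase s, if i ∈ τ.chordal then 1 else 0 := by
    rw [← Finset.card_filter, Finset.filter_mem_eq_inter, Finset.inter_eq_right.2 fun i hi =>
      Finset.mem_erase.2 ⟨ne_of_load_nonempty (mem_chordal.1 hi).1.1, Finset.mem_univ i⟩]
  rw [hbridges, hchordal, ← Finset.sum_add_distrib]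
  refine (Finset.sum_le_sum fun i _ => card_inter_load_add_le h hle hchord hE i).trans ?_
  rw [Finset.sum_add_distrib, ← Finset.card_filter]
  exact Nat.add_le_add_left
    ((Finset.card_le_card fun i hi => (Finset.mem_filter.1 hi).2).trans Finset.card_image_le) _

end Count

end BridgeCover

end BridgeCover

open scoped Classical in
theorem IsClassSystem.exists_isExtension_univ {V ι : Type*} [Fintype V] [Fintype ι]
    {G : SimpleGraph V} {C : ι → SimpleGraph V} (h : IsClassSystem G C) (hG : G.IsEdgeConnected 2)
    (s : ι) :
    ∃ H, IsExtension G (C s) H Finset.univ ∧ numEdges H + (bridges H).card ≤ numEdges (C s) +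
      (∑ i ∈ Finset.univ.erase s, ((trace C (supp (C s)) i).card - 2) +
        ∑ z ∈ (supp (C s))ᶜ, max 2 (classesThrough C s z).card) := by
  obtain ⟨τ⟩ := h.nonempty_bridgeCover s
  obtain ⟨H₀, h₀, hnum₀, hchord⟩ := τ.exists_isExtension h
  choose E hE hinner using
    fun k : {i // τ.IsTight i ∧ ¬ IsChordal (C i) (supp (C s))} => k.2.1.exists_bridgingEar h k.2.2
  obtain ⟨H, hH, hle, hnum⟩ := exists_spanning_extension E hG (h.nonempty s) (h.connectedOn s) h₀
  have hweight : ∀ z, weight E z ≤ max 2 (classesThrough C s z).card := fun z => by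
    refine max_le_max le_rfl (Finset.card_le_card_of_injOn Subtype.val (fun k hk => ?_)
      Subtype.val_injective.injOn)
    obtain ⟨z', hz', hzk⟩ := mem_touching.1 hk
    obtain rfl := Finset.mem_singleton.1 hz'
    exact Finset.mem_filter.2 ⟨Finset.mem_univ _, BridgeCover.ne_of_load_nonempty k.2.1.1,
      k.2.1.two_le_card_trace h, hinner k hzk⟩
  have hweights := Finset.sum_le_sum fun z (_ : z ∈ (supp (C s))ᶜ) => hweight z
  have hbridges := BridgeCover.card_bridges_add_card_chordal_le h hH.base_le hH.bridges_subset
    (fun i hi => by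
      obtain ⟨a, ha, b, hb, hab, habH⟩ := hchord i hi
      exact ⟨a, ha, b, hb, hab, hle habH⟩) hE
  exact ⟨H, hH, by omega⟩

open scoped Classical in
theorem IsClassSystem.exists_isEdgeConnected_two {V ι : Type*} [Finite V] [Fintype ι] [Nonempty ι]
    {G : SimpleGraph V} {C : ι → SimpleGraph V} (h : IsClassSystem G C)
    (hG : G.IsEdgeConnected 2) :
    ∃ H ≤ G, H.IsEdgeConnected 2 ∧ numEdges H + Fintype.card ι ≤ ∑ i, numEdges (C i) + 1 := by
  have := Fintype.ofFinite V
  obtain ⟨s, hmax⟩ := Finite.exists_max fun i => (supp (C i)).card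
  obtain ⟨H₁, h₁, hnum₁⟩ := h.exists_isExtension_univ hG s
  obtain ⟨H, hHG, hH, hnum⟩ := exists_isEdgeConnected_two_of_preconnected hG h₁.le fun u v =>
    h₁.connectedOn u (Finset.mem_univ u) v (Finset.mem_univ v)
  refine ⟨H, hHG, hH, ?_⟩
  have hsum := h.sum_le_sum_numEdges hmax
  have hcost : ∑ i ∈ Finset.univ.erase s, (numEdges (C i) - 1) + (Finset.univ.erase s).card =
      ∑ i ∈ Finset.univ.erase s, numEdges (C i) := by
    rw [Finset.card_eq_sum_ones, ← Finset.sum_add_distrib]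
    exact Finset.sum_congr rfl fun i _ => Nat.sub_add_cancel (numEdges_pos (h.nonempty i))
  have hcard : (Finset.univ.erase s).card + 1 = Fintype.card ι :=
    Finset.card_erase_add_one (Finset.mem_univ s)
  have htotal := Finset.sum_erase_add Finset.univ (fun i => numEdges (C i)) (Finset.mem_univ s)
  omega

/-! ### Two edge-disjoint walks -/

section DisjointWalks

variable {V : Type*} {H : SimpleGraph V} {u v w x : V}

lemma exists_disjoint_walks_of_mem (h : H.Adj v w) {p q : H.Walk w u} (hq : q.IsPath)
    (hd : p.edges.Disjoint q.edges) (he : s(v, w) ∈ q.edges) :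
    ∃ p' q' : H.Walk v u, p'.edges.Disjoint q'.edges := by
  cases q with
  | nil => exact absurd he List.not_mem_nil
  | @cons _ a _ h' q =>
    have hwq : ∀ t, s(t, w) ∉ q.edges := fun t ht =>
      ((Walk.cons_isPath_iff _ _).1 hq).2 (q.snd_mem_support_of_mem_edges ht)
    obtain rfl : v = a := by
      have hvw : s(v, w) = s(w, a) := (List.mem_cons.1 he).resolve_right (hwq v)
      rw [Sym2.eq_swap] at hvw
      exact Sym2.congr_right.1 hvw
    exact ⟨p.cons h, q, List.disjoint_cons_left.2
      ⟨hwq v, List.disjoint_of_disjoint_cons_right hd⟩⟩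

lemma exists_disjoint_walks_of_meet (h : H.Adj v w) {p q : H.Walk w u}
    (hd : p.edges.Disjoint q.edges) (hep : s(v, w) ∉ p.edges) (hx : x ∈ p.support)
    (t : H.Walk v x) (het : s(v, w) ∉ t.edges)
    (ht : ∀ y ∈ t.support, y ∈ p.support ∨ y ∈ q.support → y = x) :
    ∃ p' q' : H.Walk v u, p'.edges.Disjoint q'.edges := by
  classical
  have hdrop := p.edges_dropUntil_subset_edges hx
  have htq : q.edges.Disjoint t.edges := fun e heq het => by
    induction e with
    | _ a b =>
      have ha := ht a (t.fst_mem_support_of_mem_edges het)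
        (.inr (q.fst_mem_support_of_mem_edges heq))
      have hb := ht b (t.snd_mem_support_of_mem_edges het)
        (.inr (q.snd_mem_support_of_mem_edges heq))
      exact (t.adj_of_mem_edges het).ne (ha.trans hb.symm)
  refine ⟨q.cons h, t.append (p.dropUntil x hx), ?_⟩
  rw [Walk.edges_cons, Walk.edges_append, List.disjoint_cons_left, List.disjoint_append_right,
    List.mem_append, not_or]
  exact ⟨⟨het, fun he => hep (hdrop he)⟩, htq, List.disjoint_of_subset_right hdrop hd.symm⟩

theorem exists_disjoint_walks (hH : H.IsEdgeConnected 2) (v u : V) :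
    ∃ p q : H.Walk v u, p.edges.Disjoint q.edges := by
  classical
  obtain ⟨r⟩ := hH.preconnected two_ne_zero v u
  induction r with
  | nil => exact ⟨.nil, .nil, List.disjoint_nil_left _⟩
  | @cons v w u h _ ih =>
    obtain ⟨p, q, hp, hq, hd⟩ : ∃ p q : H.Walk w u, p.IsPath ∧ q.IsPath ∧
        p.edges.Disjoint q.edges := by
      obtain ⟨p, q, hd⟩ := ih
      exact ⟨p.bypass, q.bypass, p.bypass_isPath, q.bypass_isPath,
        fun _ hep heq =>
          hd (p.edges_bypass_subset_edges hep) (q.edges_bypass_subset_edges heq)⟩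
    by_cases heq : s(v, w) ∈ q.edges
    · exact exists_disjoint_walks_of_mem h hq hd heq
    by_cases hep : s(v, w) ∈ p.edges
    · exact exists_disjoint_walks_of_mem h hp hd.symm hep
    -- A walk from `v` to `w` avoiding the edge `vw` meets one of the two paths for the first time.
    obtain ⟨t⟩ := isEdgeConnected_two.1 hH s(v, w) v w
    obtain ⟨x, hx, hxt, ht⟩ := t.exists_mem_support_forall_mem_support_imp_eq
      (p.support.toFinset ∪ q.support.toFinset) ⟨w, by simp⟩
    simp only [Finset.mem_union, List.mem_toFinset] at hx ht
    let t' := (t.takeUntil x hxt).mapLe (deleteEdges_le {s(v, w)})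
    have het : s(v, w) ∉ t'.edges := fun he => by
      rw [Walk.edges_mapLe_eq_edges] at he
      exact (deleteEdges_adj.1 ((t.takeUntil x hxt).adj_of_mem_edges he)).2 rfl
    have ht' : ∀ y ∈ t'.support, y ∈ p.support ∨ y ∈ q.support → y = x := fun y hy hypq => by
      rw [Walk.support_mapLe_eq_support] at hy
      exact ht y hypq hy
    rcases hx with hx | hx
    · exact exists_disjoint_walks_of_meet h hd hep hx t' het ht'
    · exact exists_disjoint_walks_of_meet h hd.symm heq hx t' het fun y hy hyy => ht' y hy hyy.symm

end DisjointWalks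

/-! ### Color classes -/

lemma isEdgeReachable_of_disjoint_walks {V : Type*} {H : SimpleGraph V} {k : ℕ} {u v : V}
    {P : Fin k → H.Walk u v} (hP : ∀ i j, i ≠ j → (P i).edges.Disjoint (P j).edges) :
    H.IsEdgeReachable k u v := by
  refine fun s hs => by_contra fun hn => ?_
  have hmeet : ∀ i, ∃ e : s, (e : Sym2 V) ∈ (P i).edges := fun i => by
    by_contra! h
    exact hn ((P i).toDeleteEdges s fun e he hes => h ⟨e, hes⟩ he).reachable
  choose e he using hmeet
  have hinj : Function.Injective e := fun i j hij =>
    by_contra fun hne => hP i j hne (he i) (hij ▸ he j)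
  have hcard := ENat.card_le_card_of_injective hinj
  rw [ENat.card_coe_set_eq, ENat.card_eq_coe_fintype_card, Fintype.card_fin] at hcard
  exact hcard.not_gt hs

section ColorClasses

variable {V D : Type*} {G : SimpleGraph V} {Γ : G.edgeSet → D} {c : D} {u v : V} {e f : Sym2 V}

/-- The spanning subgraph formed by the edges of color `c`. -/
def colorGraph (Γ : G.edgeSet → D) (c : D) : SimpleGraph V :=
  fromEdgeSet {e | ∃ h : e ∈ G.edgeSet, Γ ⟨e, h⟩ = c}

lemma mem_edgeSet_colorGraph :
    e ∈ (colorGraph Γ c).edgeSet ↔ ∃ h : e ∈ G.edgeSet, Γ ⟨e, h⟩ = c := by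
  rw [colorGraph, edgeSet_fromEdgeSet]
  exact ⟨fun h => h.1, fun h => ⟨h, G.not_isDiag_of_mem_edgeSet h.1⟩⟩

lemma adj_colorGraph : (colorGraph Γ c).Adj u v ↔ ∃ h : G.Adj u v, Γ ⟨s(u, v), h⟩ = c :=
  mem_edgeSet_colorGraph (e := s(u, v))

lemma colorGraph_le (Γ : G.edgeSet → D) (c : D) : colorGraph Γ c ≤ G :=
  fun _ _ h => (adj_colorGraph.1 h).1

lemma mem_edgeSet_colorGraph_of_isMonochromatic {p : G.Walk u v} (hp : IsMonochromatic Γ p)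
    (he : e ∈ p.edges) (hec : e ∈ (colorGraph Γ c).edgeSet) (hf : f ∈ p.edges) :
    f ∈ (colorGraph Γ c).edgeSet := by
  obtain ⟨heG, rfl⟩ := mem_edgeSet_colorGraph.1 hec
  exact mem_edgeSet_colorGraph.2 ⟨p.edges_subset_edgeSet hf, hp ⟨f, _⟩ ⟨e, heG⟩ hf he⟩

lemma exists_color_of_isMonochromatic {p : G.Walk u v} (hp : IsMonochromatic Γ p) (huv : u ≠ v) :
    ∃ c, ∀ e ∈ p.edges, e ∈ (colorGraph Γ c).edgeSet := by
  have hfirst := p.mk_start_snd_mem_edges (Walk.not_nil_of_ne huv)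
  exact ⟨_, fun _ => mem_edgeSet_colorGraph_of_isMonochromatic hp hfirst
    (mem_edgeSet_colorGraph.2 ⟨p.edges_subset_edgeSet hfirst, rfl⟩)⟩

/-- The connected components of the color classes, as spanning subgraphs. -/
def colorComponent (Γ : G.edgeSet → D) (x : Σ c, (colorGraph Γ c).ConnectedComponent) :
    SimpleGraph V :=
  x.2.toSimpleGraph.spanningCoe

lemma adj_colorComponent {K : (colorGraph Γ c).ConnectedComponent} :
    (colorComponent Γ ⟨c, K⟩).Adj u v ↔
      (colorGraph Γ c).connectedComponentMk u = K ∧ (colorGraph Γ c).Adj u v := by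
  rw [colorComponent, ConnectedComponent.adj_spanningCoe_toSimpleGraph,
    ConnectedComponent.mem_supp_iff]

lemma mem_edgeSet_colorComponent (p : (colorGraph Γ c).Walk u v) (he : e ∈ p.edges) :
    e ∈ (colorComponent Γ ⟨c, (colorGraph Γ c).connectedComponentMk u⟩).edgeSet := by
  classical
  induction e with
  | _ a b =>
    exact adj_colorComponent.2 ⟨ConnectedComponent.sound
      (p.takeUntil a (p.fst_mem_support_of_mem_edges he)).reachable.symm, p.adj_of_mem_edges he⟩

lemma exists_walk_colorComponent {p : G.Walk u v} (hp : IsMonochromatic Γ p) (huv : u ≠ v) :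
    ∃ x, ∃ q : (colorComponent Γ x).Walk u v, q.edges = p.edges := by
  obtain ⟨c, hc⟩ := exists_color_of_isMonochromatic hp huv
  refine ⟨⟨c, (colorGraph Γ c).connectedComponentMk u⟩,
    (p.transfer _ hc).transfer _ fun _ => mem_edgeSet_colorComponent _, ?_⟩
  rw [Walk.edges_transfer, Walk.edges_transfer]

lemma isClassSystem_colorComponent [Finite V] (hΓ : IsMCColoring 2 Γ) :
    IsClassSystem G fun x : {x // (supp (colorComponent Γ x)).Nonempty} =>
      colorComponent Γ x.1 where
  le _ _ _ h := colorGraph_le Γ _ (adj_colorComponent.1 h).2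
  nonempty x := x.2
  disjoint := by
    rintro ⟨⟨c, K⟩, _⟩ ⟨⟨d, L⟩, _⟩ u v hK hL
    obtain ⟨rfl, hc⟩ := adj_colorComponent.1 hK
    obtain ⟨rfl, hd⟩ := adj_colorComponent.1 hL
    obtain ⟨_, rfl⟩ := adj_colorGraph.1 hc
    obtain ⟨_, rfl⟩ := adj_colorGraph.1 hd
    rfl
  connectedOn := by
    rintro ⟨⟨c, K⟩, _⟩ u hu v hv
    obtain ⟨a, hua⟩ := mem_supp.1 hu
    obtain ⟨b, hvb⟩ := mem_supp.1 hv
    obtain ⟨rfl, -⟩ := adj_colorComponent.1 hua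
    obtain ⟨hK, -⟩ := adj_colorComponent.1 hvb
    obtain ⟨p⟩ := ConnectedComponent.exact hK.symm
    exact ⟨p.transfer _ fun _ => mem_edgeSet_colorComponent p⟩
  cover := by
    intro u v huv
    obtain ⟨P, hmono, hdisj⟩ := hΓ u v huv
    obtain ⟨x, p, hp⟩ := exists_walk_colorComponent (hmono 0) huv
    obtain ⟨y, q, hq⟩ := exists_walk_colorComponent (hmono 1) huv
    refine ⟨⟨x, u, mem_supp_of_reachable p.reachable huv⟩,
      ⟨y, u, mem_supp_of_reachable q.reachable huv⟩, p.reachable, q.reachable, fun hxy => ?_⟩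
    obtain rfl : x = y := congrArg Subtype.val hxy
    have hpq : p.edges.Disjoint q.edges := hp ▸ hq ▸ hdisj 0 1 Fin.zero_ne_one
    refine isEdgeReachable_of_disjoint_walks (P := ![p, q]) ?_
    simp [Fin.forall_fin_two, hpq, hpq.symm]

end ColorClasses

lemma IsClassSystem.sum_numEdges_le {V ι : Type*} [Finite V] [Fintype ι] {G : SimpleGraph V}
    {C : ι → SimpleGraph V} (h : IsClassSystem G C) : ∑ i, numEdges (C i) ≤ numEdges G := by
  have hinj : Function.Injective fun e : Σ i, (C i).edgeSet =>
      (⟨e.2, edgeSet_mono (h.le e.1) e.2.2⟩ : G.edgeSet) := by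
    rintro ⟨i, ⟨u, v⟩, he⟩ ⟨j, f, hf⟩ hef
    obtain rfl : s(u, v) = f := congrArg Subtype.val hef
    obtain rfl := h.disjoint he hf
    rfl
  have hcard := Nat.card_le_card_of_injective _ hinj
  rw [Nat.card_sigma] at hcard
  exact hcard

theorem exists_isEdgeConnected_two_of_isMCColoring {V D : Type*} [Finite V] [Nontrivial V]
    {G : SimpleGraph V} {Γ : G.edgeSet → D} (hG : G.IsEdgeConnected 2)
    (hsurj : Function.Surjective Γ) (hΓ : IsMCColoring 2 Γ) :
    ∃ H ≤ G, H.IsEdgeConnected 2 ∧ numEdges H + Nat.card D ≤ numEdges G + 1 := by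
  have : Finite D := Finite.of_surjective Γ hsurj
  have := Fintype.ofFinite {x // (supp (colorComponent Γ x)).Nonempty}
  have hC := isClassSystem_colorComponent hΓ
  have : Nonempty {x // (supp (colorComponent Γ x)).Nonempty} := by
    obtain ⟨u, v, huv⟩ := exists_pair_ne V
    exact ⟨(hC.cover u v huv).choose⟩
  obtain ⟨H, hle, hH, hnum⟩ := hC.exists_isEdgeConnected_two hG
  have hcolors : Function.Surjective
      fun x : {x // (supp (colorComponent Γ x)).Nonempty} => x.1.1 := by
    intro c
    obtain ⟨⟨⟨u, v⟩, he⟩, hc⟩ := hsurj c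
    exact ⟨⟨⟨c, (colorGraph Γ c).connectedComponentMk u⟩, u, mem_supp.2
      ⟨v, adj_colorComponent.2 ⟨rfl, adj_colorGraph.2 ⟨he, hc⟩⟩⟩⟩, rfl⟩
  have hcard := Nat.card_le_card_of_surjective _ hcolors
  rw [Nat.card_eq_fintype_card (α := {x // _})] at hcard
  have hsum := hC.sum_numEdges_le
  exact ⟨H, hle, hH, by omega⟩

/-! ### Colorings from 2-edge-connected color classes -/

section Construction

variable {V D : Type*} {G H : SimpleGraph V} {Γ : G.edgeSet → D}

lemma isMCColoring_of_walks {ι : Type*} [Fintype ι]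
    (h : ∀ u v, u ≠ v → ∃ P : ι → G.Walk u v, (∀ i, IsMonochromatic Γ (P i)) ∧
      ∀ i j, i ≠ j → (P i).edges.Disjoint (P j).edges) :
    IsMCColoring (Fintype.card ι) Γ := by
  classical
  intro u v huv
  obtain ⟨P, hmono, hdisj⟩ := h u v huv
  have hsub : ∀ i, ((P i).toPath : G.Walk u v).edges ⊆ (P i).edges :=
    fun i => Walk.edges_toPath_subset_edges (P i)
  let φ := (Fintype.equivFin ι).symm
  exact ⟨fun i => (P (φ i)).toPath, fun i e f he hf => hmono (φ i) e f (hsub _ he) (hsub _ hf),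
    fun i j hij e hi hj => hdisj _ _ (φ.injective.ne hij) (hsub _ hi) (hsub _ hj)⟩

lemma isMonochromatic_mapLe_colorGraph {c : D} {u v : V} (p : (colorGraph Γ c).Walk u v) :
    IsMonochromatic Γ (p.mapLe (colorGraph_le Γ c)) := by
  intro e f he hf
  rw [Walk.edges_mapLe_eq_edges] at he hf
  obtain ⟨_, hec⟩ := mem_edgeSet_colorGraph.1 (p.edges_subset_edgeSet he)
  obtain ⟨_, hfc⟩ := mem_edgeSet_colorGraph.1 (p.edges_subset_edgeSet hf)
  exact hec.trans hfc.symm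

lemma disjoint_edges_of_colorGraph {c d : D} {u v x y : V} (hcd : c ≠ d)
    (p : (colorGraph Γ c).Walk u v) (q : (colorGraph Γ d).Walk x y) :
    p.edges.Disjoint q.edges := by
  intro e hp hq
  obtain ⟨_, rfl⟩ := mem_edgeSet_colorGraph.1 (p.edges_subset_edgeSet hp)
  obtain ⟨_, rfl⟩ := mem_edgeSet_colorGraph.1 (q.edges_subset_edgeSet hq)
  exact hcd rfl

theorem isMCColoring_two_mul_card {S : Finset D}
    (h : ∀ c ∈ S, (colorGraph Γ c).IsEdgeConnected 2) : IsMCColoring (2 * S.card) Γ := by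
  have hcard : Fintype.card (Fin 2 × S) = 2 * S.card := by simp
  rw [← hcard]
  refine isMCColoring_of_walks fun u v _ => ?_
  choose p q hpq using fun c : S => exists_disjoint_walks (h c c.2) u v
  refine ⟨fun x => (![p x.2, q x.2] x.1).mapLe (colorGraph_le Γ _),
    fun x => isMonochromatic_mapLe_colorGraph _, ?_⟩
  rintro ⟨i, c⟩ ⟨j, d⟩ hne
  rw [Walk.edges_mapLe_eq_edges, Walk.edges_mapLe_eq_edges]
  by_cases hcd : c = d
  · subst hcd
    fin_cases i <;> fin_cases j
    exacts [absurd rfl hne, hpq c, (hpq c).symm, absurd rfl hne]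
  · exact disjoint_edges_of_colorGraph (fun h => hcd (Subtype.ext h)) _ _

lemma mem_mcColorCounts [Finite D] {k : ℕ} (hsurj : Function.Surjective Γ)
    (hΓ : IsMCColoring k Γ) : Nat.card D ∈ mcColorCounts G k := by
  let φ := Finite.equivFin D
  refine ⟨φ ∘ Γ, φ.surjective.comp hsurj, fun u v huv => ?_⟩
  obtain ⟨P, hP, hd⟩ := hΓ u v huv
  exact ⟨P, fun i e f he hf => congrArg φ (hP i e f he hf), hd⟩

lemma exists_adj_of_isEdgeConnected_two [Nontrivial V] (hH : H.IsEdgeConnected 2) :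
    ∃ u v, H.Adj u v := by
  obtain ⟨u, -, -⟩ := exists_pair_ne V
  have hu : u ∈ H.support := (hH.preconnected two_ne_zero).support_eq_univ ▸ Set.mem_univ u
  exact ⟨u, hu⟩

/-- The edges of `H` share the color `none` and every other edge of `G` has a color of its own. -/
noncomputable def subgraphColoring (G H : SimpleGraph V) (e : G.edgeSet) :
    Option ↥(G.edgeSet \ H.edgeSet) :=
  open scoped Classical in if h : e.1 ∈ H.edgeSet then none else some ⟨e.1, e.2, h⟩

lemma subgraphColoring_eq_none {e : G.edgeSet} :
    subgraphColoring G H e = none ↔ e.1 ∈ H.edgeSet := by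
  simp [subgraphColoring]

lemma colorGraph_subgraphColoring_none (hle : H ≤ G) :
    colorGraph (subgraphColoring G H) none = H := by
  ext u v
  simp only [adj_colorGraph, subgraphColoring_eq_none, mem_edgeSet]
  exact ⟨fun h => h.2, fun h => ⟨hle h, h⟩⟩

lemma sub_add_one_mem_mcColorCounts_two [Finite V] [Nontrivial V] (hle : H ≤ G)
    (hH : H.IsEdgeConnected 2) : numEdges G - numEdges H + 1 ∈ mcColorCounts G 2 := by
  have hsurj : Function.Surjective (subgraphColoring G H) := by
    rintro (_ | ⟨e, heG, heH⟩)
    · obtain ⟨u, v, huv⟩ := exists_adj_of_isEdgeConnected_two hH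
      exact ⟨⟨s(u, v), hle huv⟩, subgraphColoring_eq_none.2 huv⟩
    · exact ⟨⟨e, heG⟩, dif_neg heH⟩
  have hcount : Nat.card (Option ↥(G.edgeSet \ H.edgeSet)) = numEdges G - numEdges H + 1 := by
    rw [Finite.card_option, Nat.card_coe_set_eq, Set.ncard_sdiff (edgeSet_mono hle), numEdges,
      numEdges]
  rw [← hcount]
  exact mem_mcColorCounts hsurj (isMCColoring_two_mul_card (S := {none}) (by
    simpa [colorGraph_subgraphColoring_none hle] using hH))

lemma exists_isMinimalECSpanning [Finite V] {k : ℕ} (hle : H ≤ G) (hH : H.IsEdgeConnected k) :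
    ∃ H' ≤ H, IsMinimalECSpanning G k H' := by
  obtain ⟨H', hle', hmin⟩ := exists_minimal_le_of_wellFoundedLT
    (fun H : SimpleGraph V => H ≤ G ∧ H.IsEdgeConnected k) H ⟨hle, hH⟩
  refine ⟨H', hle', hmin.prop.1, hmin.prop.2, fun e he hdel => ?_⟩
  have hsub := edgeSet_mono (hmin.le_of_le ⟨(deleteEdges_le _).trans hmin.prop.1, hdel⟩
    (deleteEdges_le _)) he
  rw [edgeSet_deleteEdges] at hsub
  exact hsub.2 rfl

theorem mcFormula_two [Finite V] [Nontrivial V] (hG : G.IsEdgeConnected 2) : MCFormula G 2 := by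
  rintro H ⟨⟨hle, hH, -⟩, hmin⟩
  have hnum : numEdges H ≤ numEdges G := numEdges_mono hle
  have hgreatest : IsGreatest (mcColorCounts G 2) (numEdges G - numEdges H + 1) := by
    refine ⟨sub_add_one_mem_mcColorCounts_two hle hH, ?_⟩
    rintro r ⟨Γ, hsurj, hΓ⟩
    obtain ⟨H₁, hle₁, hH₁, hr⟩ := exists_isEdgeConnected_two_of_isMCColoring hG hsurj hΓ
    obtain ⟨H₂, hle₂, hH₂⟩ := exists_isMinimalECSpanning hle₁ hH₁
    have h₁₂ := numEdges_mono hle₂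
    have hH₂min := hmin H₂ hH₂
    rw [Nat.card_fin] at hr
    omega
  rw [show mc G 2 = _ from hgreatest.csSup_eq]
  push_cast [hnum]
  rfl

end Construction

/-! ### Graphs whose edges all have an end of degree k -/

section DegreeCover

variable {V D : Type*} {G H : SimpleGraph V} {k : ℕ} {T : Set V} {Γ : G.edgeSet → D} {c : D}
  {u v x y z : V}

lemma exists_walk_of_isMCColoring [Finite V] (hΓ : IsMCColoring k Γ) (huv : u ≠ v)
    (hu : (G.neighborSet u).ncard = k) :
    ∃ p : G.neighborSet u → G.Walk u v, (∀ w, s(u, w.1) ∈ (p w).edges) ∧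
      (∀ w, IsMonochromatic Γ (p w)) ∧ ∀ w w', w ≠ w' → (p w).edges.Disjoint (p w').edges := by
  obtain ⟨P, hmono, hdisj⟩ := hΓ u v huv
  have hnil : ∀ i, ¬ (P i : G.Walk u v).Nil := fun _ => Walk.not_nil_of_ne huv
  have hfirst : ∀ i, s(u, (P i : G.Walk u v).snd) ∈ (P i : G.Walk u v).edges :=
    fun i => Walk.mk_start_snd_mem_edges (hnil i)
  let first : Fin k → G.neighborSet u := fun i => ⟨(P i : G.Walk u v).snd, Walk.adj_snd (hnil i)⟩
  have hinj : Function.Injective first := fun i j hij => by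
    by_contra hne
    have hsnd : (P i : G.Walk u v).snd = (P j : G.Walk u v).snd := congrArg Subtype.val hij
    exact hdisj i j hne (hfirst i) (hsnd ▸ hfirst j)
  -- `u` has only `k` edges, so every one of them is the first edge of one of the `k` paths.
  have hbij : Function.Bijective first := hinj.bijective_of_nat_card_le (by
    rw [Nat.card_coe_set_eq, hu, Nat.card_fin])
  choose i hi using hbij.surjective
  refine ⟨fun w => P (i w), fun w => ?_, fun w => hmono _,
    fun w w' hne => hdisj _ _ fun h => hne ?_⟩
  · have hsnd : (P (i w) : G.Walk u v).snd = w := congrArg Subtype.val (hi w)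
    exact hsnd ▸ hfirst (i w)
  · rw [← hi w, ← hi w', h]

lemma ncard_neighborSet_colorGraph_le [Finite V] (hΓ : IsMCColoring k Γ)
    (hu : (G.neighborSet u).ncard = k) (c : D) (v : V) :
    ((colorGraph Γ c).neighborSet u).ncard ≤ ((colorGraph Γ c).neighborSet v).ncard := by
  obtain rfl | huv := eq_or_ne u v
  · rfl
  obtain ⟨p, hfirst, hmono, hdisj⟩ := exists_walk_of_isMCColoring hΓ huv hu
  have hlast : ∀ w, s((p w).penultimate, v) ∈ (p w).edges :=
    fun w => Walk.mk_penultimate_end_mem_edges (Walk.not_nil_of_ne huv)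
  let incl : (colorGraph Γ c).neighborSet u → G.neighborSet u :=
    Set.inclusion fun _ hw => colorGraph_le Γ c hw
  have hadj : ∀ w, (colorGraph Γ c).Adj v (p (incl w)).penultimate := fun w =>
    Adj.symm (mem_edgeSet_colorGraph_of_isMonochromatic (hmono _) (hfirst (incl w)) w.2 (hlast _))
  rw [← Nat.card_coe_set_eq, ← Nat.card_coe_set_eq]
  refine Nat.card_le_card_of_injective (fun w =>
    (⟨(p (incl w)).penultimate, hadj w⟩ : (colorGraph Γ c).neighborSet v)) fun w w' hww' => ?_
  by_contra hne
  have hpen : (p (incl w)).penultimate = (p (incl w')).penultimate := congrArg Subtype.val hww'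
  exact hdisj (incl w) (incl w') ((Set.inclusion_injective _).ne hne) (hpen ▸ hlast _) (hlast _)

lemma preconnected_colorGraph [Finite V] (hΓ : IsMCColoring k Γ)
    (hu : (G.neighborSet u).ncard = k) (huv : (colorGraph Γ c).Adj u v) :
    (colorGraph Γ c).Preconnected := by
  have hreach : ∀ z, (colorGraph Γ c).Reachable u z := by
    intro z
    obtain rfl | huz := eq_or_ne u z
    · rfl
    obtain ⟨p, hfirst, hmono, -⟩ := exists_walk_of_isMCColoring hΓ huz hu
    let w : G.neighborSet u := ⟨v, colorGraph_le Γ c huv⟩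
    exact ⟨(p w).transfer _ fun _ =>
      mem_edgeSet_colorGraph_of_isMonochromatic (hmono w) (hfirst w) huv⟩
  exact fun y z => (hreach y).symm.trans (hreach z)

lemma adj_of_forall_subsingleton_neighborSet (hH : H.Preconnected)
    (hT : ∀ u ∈ T, (H.neighborSet u).Subsingleton) (hcover : ∀ u v, H.Adj u v → u ∈ T ∨ v ∈ T)
    (hx : x ∈ T) (hxy : H.Adj x y) (hzy : z ≠ y) : H.Adj z y := by
  by_contra hz
  obtain ⟨p⟩ := hH x z
  obtain ⟨d, -, hfst, hsnd⟩ := p.exists_boundary_dart {w | w = y ∨ H.Adj w y} (.inr hxy)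
    (not_or.2 ⟨hzy, hz⟩)
  obtain ⟨hsnd_ne, hsnd_adj⟩ := not_or.1 hsnd
  obtain hfst | hfst := hfst
  · exact hsnd_adj (hfst ▸ d.adj.symm)
  · have hfstT : d.fst ∉ T := fun h => hsnd_ne (hT _ h d.adj hfst)
    have hyT : y ∈ T := (hcover _ _ hfst).resolve_left hfstT
    exact hfstT (hT y hyT hxy.symm hfst.symm ▸ hx)

lemma neighborSet_subset_of_forall_adj [Finite V] (hΓ : IsMCColoring k Γ)
    (hx : (G.neighborSet x).ncard = k) (hxy : x ≠ y)
    (hstar : ∀ z, z ≠ y → (colorGraph Γ c).Adj z y) :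
    G.neighborSet x ⊆ (colorGraph Γ c).neighborSet x := by
  intro z hz
  have hxz : (colorGraph Γ (Γ ⟨s(x, z), hz⟩)).Adj x z := adj_colorGraph.2 ⟨hz, rfl⟩
  have : Nontrivial V := ⟨x, y, hxy⟩
  -- Every color at `x` also occurs at `y`, where all edges have color `c`.
  obtain ⟨t, hyt⟩ : ∃ t, (colorGraph Γ (Γ ⟨s(x, z), hz⟩)).Adj y t := by
    rw [← mem_support, (preconnected_colorGraph hΓ hx hxz).support_eq_univ]
    trivial
  obtain ⟨_, hzt⟩ := adj_colorGraph.1 hyt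
  obtain ⟨_, hct⟩ := adj_colorGraph.1 (hstar t hyt.ne').symm
  exact adj_colorGraph.2 ⟨hz, hzt.symm.trans hct⟩

lemma two_le_ncard_neighborSet_colorGraph [Finite V] (hΓ : IsMCColoring k Γ) (hk : 2 ≤ k)
    (hT : ∀ u ∈ T, (G.neighborSet u).ncard = k) (hcover : ∀ u v, G.Adj u v → u ∈ T ∨ v ∈ T)
    (hx : x ∈ T) (hxy : (colorGraph Γ c).Adj x y) :
    2 ≤ ((colorGraph Γ c).neighborSet x).ncard := by
  by_contra! hlt
  have hleaf : ∀ z ∈ T, ((colorGraph Γ c).neighborSet z).Subsingleton := fun z hz =>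
    (Set.ncard_le_one_iff_subsingleton).1
      ((ncard_neighborSet_colorGraph_le hΓ (hT z hz) c x).trans (Nat.le_of_lt_succ hlt))
  -- The color class is a star with center `y`.
  have hstar : ∀ z, z ≠ y → (colorGraph Γ c).Adj z y := fun z =>
    adj_of_forall_subsingleton_neighborSet (preconnected_colorGraph hΓ (hT x hx) hxy) hleaf
      (fun u v h => hcover u v (colorGraph_le Γ c h)) hx hxy
  have hle := Set.ncard_le_ncard (neighborSet_subset_of_forall_adj hΓ (hT x hx) hxy.ne hstar)
  rw [hT x hx] at hle
  omega

lemma sum_ncard_neighborSet_colorGraph_le [Finite V] [Fintype D] (Γ : G.edgeSet → D) (x : V) :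
    ∑ c, ((colorGraph Γ c).neighborSet x).ncard ≤ (G.neighborSet x).ncard := by
  have hinj : Function.Injective fun p : Σ c, (colorGraph Γ c).neighborSet x =>
      (⟨p.2, colorGraph_le Γ p.1 p.2.2⟩ : G.neighborSet x) := by
    rintro ⟨c, w, hw⟩ ⟨d, w', hw'⟩ h
    obtain rfl : w = w' := congrArg Subtype.val h
    obtain ⟨_, rfl⟩ := adj_colorGraph.1 hw
    obtain ⟨_, rfl⟩ := adj_colorGraph.1 hw'
    rfl
  have hcard := Nat.card_le_card_of_injective _ hinj
  rw [Nat.card_sigma] at hcard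
  exact hcard

theorem two_mul_card_le_of_isMCColoring [Finite V] [Fintype D] (hΓ : IsMCColoring k Γ)
    (hsurj : Function.Surjective Γ) (hk : 2 ≤ k) (hT : ∀ u ∈ T, (G.neighborSet u).ncard = k)
    (hcover : ∀ u v, G.Adj u v → u ∈ T ∨ v ∈ T) (hne : T.Nonempty) :
    2 * Fintype.card D ≤ k := by
  obtain ⟨x, hx⟩ := hne
  have htwo : ∀ c, 2 ≤ ((colorGraph Γ c).neighborSet x).ncard := by
    intro c
    obtain ⟨⟨⟨a, b⟩, hab⟩, hc⟩ := hsurj c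
    have habc : (colorGraph Γ c).Adj a b := adj_colorGraph.2 ⟨hab, hc⟩
    obtain ⟨u, v, hu, huv⟩ : ∃ u v, u ∈ T ∧ (colorGraph Γ c).Adj u v :=
      (hcover a b hab).elim (fun h => ⟨a, b, h, habc⟩) fun h => ⟨b, a, h, habc.symm⟩
    exact (two_le_ncard_neighborSet_colorGraph hΓ hk hT hcover hu huv).trans
      (ncard_neighborSet_colorGraph_le hΓ (hT u hu) c x)
  calc 2 * Fintype.card D = ∑ _c : D, 2 := by
        rw [Finset.sum_const, Finset.card_univ, smul_eq_mul, mul_comm]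
    _ ≤ ∑ c, ((colorGraph Γ c).neighborSet x).ncard := Finset.sum_le_sum fun c _ => htwo c
    _ ≤ k := (sum_ncard_neighborSet_colorGraph_le Γ x).trans_eq (hT x hx)

lemma eq_of_le_of_isEdgeConnected [Finite V] [Nontrivial V]
    (hT : ∀ u ∈ T, (G.neighborSet u).ncard = k) (hcover : ∀ u v, G.Adj u v → u ∈ T ∨ v ∈ T)
    (hle : H ≤ G) (hH : H.IsEdgeConnected k) : H = G := by
  have hadj : ∀ u ∈ T, ∀ v, G.Adj u v → H.Adj u v := by
    intro u hu v huv
    have := Fintype.ofFinite (H.neighborSet u)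
    have hdeg : k ≤ (H.neighborSet u).ncard := by
      rw [← Nat.card_coe_set_eq, Nat.card_eq_fintype_card, card_neighborSet_eq_degree]
      exact hH.le_degree
    have heq : H.neighborSet u = G.neighborSet u :=
      Set.eq_of_subset_of_ncard_le (fun _ hw => hle hw) ((hT u hu).trans_le hdeg)
    exact heq.ge huv
  exact hle.antisymm fun u v huv =>
    (hcover u v huv).elim (fun h => hadj u h v huv) fun h => (hadj v h u huv.symm).symm

theorem mcFormula_of_forall_ncard_neighborSet_eq [Finite V] (hk : 2 ≤ k)
    (hT : ∀ u ∈ T, (G.neighborSet u).ncard = k) (hcover : ∀ u v, G.Adj u v → u ∈ T ∨ v ∈ T)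
    (hne : T.Nonempty) (hmem : k / 2 ∈ mcColorCounts G k) :
    G.IsEdgeConnected k ∧ MCFormula G k ∧ mc G k = k / 2 := by
  have hbound : k / 2 ∈ upperBounds (mcColorCounts G k) := by
    rintro s ⟨Γ, hsurj, hΓ⟩
    have := two_mul_card_le_of_isMCColoring hΓ hsurj hk hT hcover hne
    rw [Fintype.card_fin] at this
    omega
  have hmc : mc G k = k / 2 := IsGreatest.csSup_eq ⟨hmem, hbound⟩
  obtain ⟨Γ, -, hΓ⟩ := hmem
  have hG : G.IsEdgeConnected k := by
    intro u v
    obtain rfl | huv := eq_or_ne u v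
    · exact .rfl
    · obtain ⟨P, -, hdisj⟩ := hΓ u v huv
      exact isEdgeReachable_of_disjoint_walks hdisj
  have : Nontrivial V := by
    obtain ⟨x, hx⟩ := hne
    obtain ⟨y, hxy⟩ : (G.neighborSet x).Nonempty :=
      Set.nonempty_of_ncard_ne_zero (by rw [hT x hx]; omega)
    exact ⟨x, y, Adj.ne hxy⟩
  refine ⟨hG, fun H hH => ?_, hmc⟩
  rw [eq_of_le_of_isEdgeConnected hT hcover hH.1.1 hH.1.2.1, hmc, sub_self, zero_add]

end DegreeCover

/-! ### Decompositions into 2-edge-connected color classes -/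

section Decompositions

variable {V D : Type*} {G H : SimpleGraph V}

lemma reachable_of_forall_reachable_succ {f : ℕ → V} {a b : ℕ} (hab : a ≤ b)
    (h : ∀ j, a ≤ j → j < b → H.Reachable (f j) (f (j + 1))) : H.Reachable (f a) (f b) := by
  induction b, hab using Nat.le_induction with
  | base => rfl
  | succ b hab ih =>
    exact (ih fun j ha hb => h j ha (hb.trans b.lt_succ_self)).trans (h b hab b.lt_succ_self)

lemma isEdgeReachable_two_of_closed_chain {f : ℕ → V} {m i : ℕ} (hf : f m = f 0)
    {p : ∀ j : Fin m, H.Walk (f j) (f (j + 1))}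
    (hp : Pairwise fun i j => (p i).edges.Disjoint (p j).edges) (hi : i ≤ m) :
    H.IsEdgeReachable 2 (f 0) (f i) := by
  rw [isEdgeReachable_two]
  intro e
  obtain ⟨t, ht⟩ : ∃ t, ∀ j (hj : j < m), j ≠ t → e ∉ (p ⟨j, hj⟩).edges := by
    by_cases h : ∃ t : Fin m, e ∈ (p t).edges
    · obtain ⟨t, het⟩ := h
      exact ⟨t, fun j hj hjt hej => hp (Fin.ne_of_val_ne hjt) hej het⟩
    · exact ⟨0, fun j hj _ hej => h ⟨_, hej⟩⟩
  have hstep : ∀ j < m, j ≠ t → (H.deleteEdges {e}).Reachable (f j) (f (j + 1)) :=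
    fun j hj hjt => ((p ⟨j, hj⟩).toDeleteEdge e (ht j hj hjt)).reachable
  obtain hit | hti := le_or_gt i t
  · exact reachable_of_forall_reachable_succ i.zero_le fun j _ hj => hstep j (by omega) (by omega)
  · rw [← hf]
    exact (reachable_of_forall_reachable_succ hi fun j _ hj => hstep j hj (by omega)).symm

lemma isEdgeReachable_two_of_adj_of_adj {w x y z : V} (hx : H.IsEdgeReachable 2 z x)
    (hy : H.IsEdgeReachable 2 z y) (hxy : x ≠ y) (hxw : H.Adj x w) (hyw : H.Adj y w) :
    H.IsEdgeReachable 2 z w := by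
  rw [isEdgeReachable_two] at *
  intro e
  obtain rfl | he := eq_or_ne s(x, w) e
  · exact (hy _).trans (Adj.reachable (deleteEdges_adj.2 ⟨hyw, fun h => hxy
      (Sym2.congr_left.1 h).symm⟩))
  · exact (hx e).trans (Adj.reachable (deleteEdges_adj.2 ⟨hxw, he⟩))

lemma eq_of_cycle_edge_eq {f : ℕ → V} {m i j : ℕ} (hm : 3 ≤ m) (hf : f m = f 0)
    (hinj : Set.InjOn f (Set.Iio m)) (hi : i < m) (hj : j < m)
    (h : s(f i, f (i + 1)) = s(f j, f (j + 1))) : i = j := by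
  have hsucc : ∀ {i j}, i < m → j < m → f i = f (j + 1) → i = j + 1 ∨ (i = 0 ∧ j + 1 = m) := by
    intro i j hi hj h
    obtain hjm | hjm := (Nat.succ_le_of_lt hj).eq_or_lt
    · exact .inr ⟨hinj hi (Nat.zero_lt_of_lt hi) (by rw [h, ← hf, ← hjm]), hjm⟩
    · exact .inl (hinj hi hjm h)
  obtain ⟨h, -⟩ | ⟨hij, hji⟩ := Sym2.eq_iff.1 h
  · exact hinj hi hj h
  · have := hsucc hi hj hij
    have := hsucc hj hi hji.symm
    omega

lemma isEdgeConnected_two_of_hamiltonian_cycle [Finite V] {f : ℕ → V} (hcard : 3 ≤ Nat.card V)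
    (hf : f (Nat.card V) = f 0) (hinj : Set.InjOn f (Set.Iio (Nat.card V)))
    (hadj : ∀ i < Nat.card V, H.Adj (f i) (f (i + 1))) : H.IsEdgeConnected 2 := by
  have himage : f '' Set.Iio (Nat.card V) = Set.univ := by
    refine Set.eq_of_subset_of_ncard_le (Set.subset_univ _) ?_
    rw [hinj.ncard_image, Set.ncard_univ, ← Nat.card_coe_set_eq]
    simp
  have hreach : ∀ x, H.IsEdgeReachable 2 (f 0) x := by
    intro x
    obtain ⟨i, hi, rfl⟩ : x ∈ f '' Set.Iio (Nat.card V) := himage ▸ Set.mem_univ x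
    refine isEdgeReachable_two_of_closed_chain hf
      (p := fun j => (hadj j j.2).toWalk) (fun i j hij => ?_) (le_of_lt hi)
    simp only [Walk.edges_cons, Walk.edges_nil, List.disjoint_singleton, List.mem_singleton]
    exact fun h => hij (Fin.ext (eq_of_cycle_edge_eq hcard hf hinj i.2 j.2 h.symm))
  exact fun x y => (hreach x).symm.trans (hreach y)

lemma card_mem_mcColorCounts [Finite V] [Nontrivial V] [Fintype D] {Γ : G.edgeSet → D}
    (h : ∀ c, (colorGraph Γ c).IsEdgeConnected 2) :
    Fintype.card D ∈ mcColorCounts G (2 * Fintype.card D) := by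
  have hsurj : Function.Surjective Γ := by
    intro c
    obtain ⟨u, v, huv⟩ := exists_adj_of_isEdgeConnected_two (h c)
    obtain ⟨_, hc⟩ := adj_colorGraph.1 huv
    exact ⟨_, hc⟩
  rw [← Nat.card_eq_fintype_card]
  refine mem_mcColorCounts hsurj ?_
  rw [Nat.card_eq_fintype_card]
  exact isMCColoring_two_mul_card (S := Finset.univ) fun c _ => h c

/-- The edge-coloring of `G` given by a symmetric function of the two ends. -/
def symmColoring (G : SimpleGraph V) (col : V → V → D) (hcol : ∀ x y, col x y = col y x)
    (e : G.edgeSet) : D :=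
  Sym2.lift ⟨col, hcol⟩ e.1

lemma adj_colorGraph_symmColoring {col : V → V → D} {hcol : ∀ x y, col x y = col y x} {c : D}
    {x y : V} : (colorGraph (symmColoring G col hcol) c).Adj x y ↔ G.Adj x y ∧ col x y = c := by
  rw [adj_colorGraph, ← exists_prop]
  rfl

/-- The residues modulo `2 * m` grouped into the `m` pairs `{2 * c, 2 * c + 1}`: `halfResidue m s`
is the index of the pair containing `s`. It colors both decompositions below. -/
def halfResidue (m s : ℕ) [NeZero m] : Fin m :=
  ⟨s % (2 * m) / 2, Nat.div_lt_of_lt_mul (Nat.mod_lt s (Nat.mul_pos two_pos (NeZero.pos m)))⟩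

lemma halfResidue_eq {m s d : ℕ} [NeZero m] {c : Fin m} (hd : d < 2)
    (h : s % (2 * m) = 2 * c + d) : halfResidue m s = c :=
  Fin.ext (by simp only [halfResidue]; omega)

/-! ### The complete graph on an odd number of vertices -/

/-- The color of the pair `x`, `y` in Walecki's decomposition of `K_{2m+1}` into Hamiltonian cycles.
The vertices are the residues modulo `2 * m` and a hub, numbered `2 * m`; two residues are colored
by their sum, and the edge from `x` to the hub as if it were a loop at `x`. -/
def zigzagColor (m x y : ℕ) [NeZero m] : Fin m :=
  halfResidue m (if x = 2 * m then y + y else if y = 2 * m then x + x else x + y)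

/-- The `s`-th vertex of the cycle of color `c` in Walecki's decomposition: the cycle runs from the
hub through `c`, `c + 1`, `c - 1`, `c + 2`, `c - 2`, …, `c + m` and back to the hub. -/
def zigzag (m c s : ℕ) : ℕ :=
  if s = 0 ∨ 2 * m < s then 2 * m
  else if s % 2 = 0 then c + s / 2
  else if s / 2 ≤ c then c - s / 2 else c + 2 * m - s / 2

lemma zigzagColor_comm (m x y : ℕ) [NeZero m] : zigzagColor m x y = zigzagColor m y x := by
  unfold zigzagColor
  congr 1
  split_ifs <;> omega

lemma zigzag_lt {m c : ℕ} (hc : c < m) (s : ℕ) : zigzag m c s < 2 * m + 1 := by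
  unfold zigzag
  split_ifs <;> omega

lemma zigzag_injOn {m c : ℕ} (hc : c < m) : Set.InjOn (zigzag m c) (Set.Iio (2 * m + 1)) := by
  intro i hi j hj h
  rw [Set.mem_Iio] at hi hj
  unfold zigzag at h
  split_ifs at h <;> omega

lemma zigzag_ne_zigzag_succ {m c i : ℕ} (hc : c < m) (hi : i < 2 * m + 1) :
    zigzag m c i ≠ zigzag m c (i + 1) := by
  grind [zigzag]

lemma zigzagColor_zigzag {m i : ℕ} [NeZero m] (c : Fin m) (hi : i < 2 * m + 1) :
    zigzagColor m (zigzag m c i) (zigzag m c (i + 1)) = c := by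
  have hc := c.2
  refine halfResidue_eq (d := i % 2) (Nat.mod_lt _ two_pos) ?_
  set s := ite (zigzag m c i = 2 * m) _ _
  have hsum : s = 2 * c + i % 2 ∨ s = 2 * c + i % 2 + 2 * m := by
    grind [zigzag]
  obtain hsum | hsum := hsum <;> rw [hsum]
  · exact Nat.mod_eq_of_lt (by omega)
  · rw [Nat.add_mod_right, Nat.mod_eq_of_lt (by omega)]

lemma isEdgeConnected_two_colorGraph_zigzag {m : ℕ} [NeZero m] (c : Fin m) :
    (colorGraph (symmColoring (completeGraph (Fin (2 * m + 1)))
      (fun x y => zigzagColor m x y) fun x y => zigzagColor_comm m x y) c).IsEdgeConnected 2 := by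
  have hm := NeZero.pos m
  have hcard : Nat.card (Fin (2 * m + 1)) = 2 * m + 1 := Nat.card_fin _
  refine isEdgeConnected_two_of_hamiltonian_cycle
    (f := fun s => (⟨zigzag m c s, zigzag_lt c.2 s⟩ : Fin (2 * m + 1))) ?_ ?_ ?_ ?_ <;> rw [hcard]
  · omega
  · simp [zigzag]
  · exact fun i hi j hj h => zigzag_injOn c.2 hi hj (Fin.mk.inj h)
  · exact fun i hi => adj_colorGraph_symmColoring.2
      ⟨fun h => zigzag_ne_zigzag_succ c.2 hi (Fin.mk.inj h), zigzagColor_zigzag c hi⟩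

lemma ncard_neighborSet_completeGraph [Finite V] (u : V) :
    ((completeGraph V).neighborSet u).ncard = Nat.card V - 1 := by
  have hcompl : (completeGraph V).neighborSet u = {u}ᶜ := Set.ext fun _ => ne_comm
  rw [hcompl, Set.ncard_compl, Set.ncard_singleton]

theorem mcFormula_completeGraph {m : ℕ} [NeZero m] :
    (completeGraph (Fin (2 * m + 1))).IsEdgeConnected (2 * m) ∧
      MCFormula (completeGraph (Fin (2 * m + 1))) (2 * m) ∧
      mc (completeGraph (Fin (2 * m + 1))) (2 * m) = m := by
  have hm := NeZero.pos m
  have : Nontrivial (Fin (2 * m + 1)) := Fin.nontrivial_iff_two_le.2 (by omega)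
  have hhalf : 2 * m / 2 = m := Nat.mul_div_cancel_left m two_pos
  have hmem := card_mem_mcColorCounts (isEdgeConnected_two_colorGraph_zigzag (m := m))
  rw [Fintype.card_fin] at hmem
  have hformula := mcFormula_of_forall_ncard_neighborSet_eq (T := Set.univ)
    (G := completeGraph (Fin (2 * m + 1))) (k := 2 * m) (by omega)
    (fun u _ => by rw [ncard_neighborSet_completeGraph, Nat.card_fin, Nat.add_sub_cancel])
    (fun _ _ _ => .inl trivial) Set.univ_nonempty (by rwa [hhalf])
  rwa [hhalf] at hformula

end Decompositions

/-! ### Complete bipartite graphs -/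

lemma ncard_neighborSet_completeBipartiteGraph_inr {α β : Type*} (b : β) :
    ((completeBipartiteGraph α β).neighborSet (Sum.inr b)).ncard = Nat.card α := by
  have hrange : (completeBipartiteGraph α β).neighborSet (Sum.inr b) = Set.range Sum.inl := by
    ext (a | b) <;> simp
  rw [hrange, ← Set.image_univ, Set.ncard_image_of_injective _ Sum.inl_injective, Set.ncard_univ]

theorem mcFormula_completeBipartiteGraph {k n : ℕ} [NeZero n] (hk : 2 ≤ k)
    (hmem : k / 2 ∈ mcColorCounts (completeBipartiteGraph (Fin k) (Fin n)) k) :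
    (completeBipartiteGraph (Fin k) (Fin n)).IsEdgeConnected k ∧
      MCFormula (completeBipartiteGraph (Fin k) (Fin n)) k ∧
      mc (completeBipartiteGraph (Fin k) (Fin n)) k = k / 2 := by
  refine mcFormula_of_forall_ncard_neighborSet_eq (T := Set.range Sum.inr) hk ?_ ?_
    (Set.range_nonempty _) hmem
  · rintro - ⟨b, rfl⟩
    rw [ncard_neighborSet_completeBipartiteGraph_inr, Nat.card_fin]
  · rintro (a | b) (a' | b') <;> simp

/-- The residue modulo `k` whose sum with `j` is congruent to `s`. The summand `(k - 1) * j` stands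
for `-j`. -/
def complement (k s j : ℕ) [NeZero k] : Fin k := Fin.ofNat k (s + (k - 1) * j)

section Complement

variable {k s : ℕ} [NeZero k]

lemma add_complement_mod (hs : s < k) (j : ℕ) : (j + complement k s j) % k = s := by
  obtain ⟨k, rfl⟩ := Nat.exists_eq_succ_of_ne_zero (NeZero.ne k)
  rw [complement, Fin.val_ofNat, Nat.add_mod_mod, Nat.succ_eq_add_one, Nat.add_sub_cancel,
    show j + (s + k * j) = s + (k + 1) * j by ring, Nat.add_mul_mod_self_left,
    Nat.mod_eq_of_lt hs]

lemma complement_succ_succ (s j : ℕ) : complement k (s + 1) (j + 1) = complement k s j := by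
  obtain ⟨k, rfl⟩ := Nat.exists_eq_succ_of_ne_zero (NeZero.ne k)
  ext
  rw [complement, complement, Fin.val_ofNat, Fin.val_ofNat, Nat.succ_eq_add_one,
    Nat.add_sub_cancel, show s + 1 + k * (j + 1) = s + k * j + (k + 1) by ring, Nat.add_mod_right]

lemma complement_self (k s : ℕ) [NeZero k] : complement k s k = complement k s 0 := by
  ext
  rw [complement, complement, Fin.val_ofNat, Fin.val_ofNat, Nat.add_mul_mod_self_right,
    Nat.mul_zero, Nat.add_zero]

lemma complement_ne_complement_succ (hs : s + 1 < k) (j : ℕ) :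
    complement k s j ≠ complement k (s + 1) j := by
  intro h
  have hsum := add_complement_mod hs j
  rw [← h, add_complement_mod (Nat.lt_of_succ_lt hs) j] at hsum
  exact s.succ_ne_self hsum.symm

end Complement

section EvenBipartite

variable {m n : ℕ} [NeZero m]

/-- The sum of the indices of two vertices determines the color of the edge between them. -/
def sumColor (m n : ℕ) [NeZero m] (x y : Fin (2 * m) ⊕ Fin n) : Fin m :=
  halfResidue m (x.elim Fin.val Fin.val + y.elim Fin.val Fin.val)

lemma sumColor_comm (x y : Fin (2 * m) ⊕ Fin n) : sumColor m n x y = sumColor m n y x := by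
  rw [sumColor, sumColor, Nat.add_comm]

lemma halfResidue_add_complement (c : Fin m) {d : ℕ} (hd : d < 2) (j : ℕ) :
    halfResidue m (j + complement (2 * m) (2 * c + d) j) = c :=
  halfResidue_eq hd (add_complement_mod (by omega) j)

variable {H : SimpleGraph (Fin (2 * m) ⊕ Fin n)} {c : Fin m}

lemma adj_complement_inr
    (hH : ∀ (i : Fin (2 * m)) (j : Fin n), halfResidue m (i + j) = c → H.Adj (.inl i) (.inr j))
    {d : ℕ} (hd : d < 2) (j : Fin n) :
    H.Adj (.inl (complement (2 * m) (2 * c + d) j)) (.inr j) :=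
  hH _ j (by rw [Nat.add_comm, halfResidue_add_complement c hd])

lemma isEdgeReachable_two_complement
    (hH : ∀ (i : Fin (2 * m)) (j : Fin n), halfResidue m (i + j) = c → H.Adj (.inl i) (.inr j))
    (hn : 2 * m ≤ n) {t : ℕ} (ht : t ≤ 2 * m) :
    H.IsEdgeReachable 2 (.inl (complement (2 * m) (2 * c + 1) 0))
      (.inl (complement (2 * m) (2 * c + 1) t)) := by
  have hleft (j : Fin (2 * m)) := adj_complement_inr hH one_lt_two (j.castLE hn)
  have hright (j : Fin (2 * m)) : H.Adj (.inr (j.castLE hn))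
      (.inl (complement (2 * m) (2 * c + 1) (j + 1))) := by
    rw [complement_succ_succ]
    exact (adj_complement_inr hH two_pos (j.castLE hn)).symm
  refine isEdgeReachable_two_of_closed_chain
    (f := fun t => .inl (complement (2 * m) (2 * c + 1) t))
    (p := fun j => .cons (hleft j) (.cons (hright j) .nil)) (by rw [complement_self]) ?_ ht
  intro i j hij
  have hne : i.castLE hn ≠ j.castLE hn := fun h => hij (Fin.castLE_injective hn h)
  simp only [Walk.edges_cons, Walk.edges_nil, List.Disjoint, List.mem_cons, List.not_mem_nil]
  grind

lemma isEdgeConnected_two_of_halfResidue_adj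
    (hH : ∀ (i : Fin (2 * m)) (j : Fin n), halfResidue m (i + j) = c → H.Adj (.inl i) (.inr j))
    (hn : 2 * m ≤ n) : H.IsEdgeConnected 2 := by
  have hne (j : ℕ) : complement (2 * m) (2 * c + 0) j ≠ complement (2 * m) (2 * c + 1) j :=
    complement_ne_complement_succ (by omega) j
  set z : Fin (2 * m) ⊕ Fin n := .inl (complement (2 * m) (2 * c + 1) 0)
  have hfew : ∀ j : Fin (2 * m), H.IsEdgeReachable 2 z (.inr (j.castLE hn)) := by
    intro j
    have hsucc := isEdgeReachable_two_complement hH hn (Nat.succ_le_of_lt j.2)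
    rw [Nat.succ_eq_add_one, complement_succ_succ] at hsucc
    exact isEdgeReachable_two_of_adj_of_adj hsucc (isEdgeReachable_two_complement hH hn j.2.le)
      (Sum.inl_injective.ne (hne j)) (adj_complement_inr hH two_pos (j.castLE hn))
      (adj_complement_inr hH one_lt_two (j.castLE hn))
  have hinl : ∀ i, H.IsEdgeReachable 2 z (.inl i) := fun i =>
    isEdgeReachable_two_of_adj_of_adj (hfew _) (hfew _)
      (fun h => hne i (Fin.castLE_injective hn (Sum.inr_injective h)))
      (hH i _ (halfResidue_add_complement c two_pos i)).symm
      (hH i _ (halfResidue_add_complement c one_lt_two i)).symm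
  have hinr : ∀ j, H.IsEdgeReachable 2 z (.inr j) := fun j =>
    isEdgeReachable_two_of_adj_of_adj (hinl _) (hinl _) (Sum.inl_injective.ne (hne j))
      (adj_complement_inr hH two_pos j) (adj_complement_inr hH one_lt_two j)
  have hall : ∀ x, H.IsEdgeReachable 2 z x := Sum.rec hinl hinr
  exact fun x y => (hall x).symm.trans (hall y)

theorem mem_mcColorCounts_completeBipartiteGraph_two_mul (hn : 2 * m ≤ n) :
    m ∈ mcColorCounts (completeBipartiteGraph (Fin (2 * m)) (Fin n)) (2 * m) := by
  have : Nontrivial (Fin (2 * m)) := Fin.nontrivial_iff_two_le.2 (by have := NeZero.pos m; omega)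
  have : Nontrivial (Fin (2 * m) ⊕ Fin n) := Sum.inl_injective.nontrivial
  have hmem := card_mem_mcColorCounts
    (Γ := symmColoring (completeBipartiteGraph _ _) (sumColor m n) sumColor_comm) fun c =>
    isEdgeConnected_two_of_halfResidue_adj
      (fun i j h => adj_colorGraph_symmColoring.2 ⟨by simp, h⟩) hn
  rwa [Fintype.card_fin] at hmem

end EvenBipartite

section MonochromaticBipartite

variable {k n : ℕ}

lemma exists_disjoint_walks_completeBipartiteGraph_inl_inr (hn : k ≤ n) (a : Fin k) (b : Fin n) :
    ∃ P : Fin k → (completeBipartiteGraph (Fin k) (Fin n)).Walk (.inl a) (.inr b),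
      ∀ i j, i ≠ j → (P i).edges.Disjoint (P j).edges := by
  have hadj : ∀ a b, (completeBipartiteGraph (Fin k) (Fin n)).Adj (.inl a) (.inr b) := by simp
  obtain ⟨σ, hσ, hσa⟩ : ∃ σ : Fin k → Fin n, Function.Injective σ ∧ σ a = b :=
    ⟨fun i => Equiv.swap (Fin.castLE hn a) b (Fin.castLE hn i),
      (Equiv.injective _).comp (Fin.castLE_injective hn), Equiv.swap_apply_left _ _⟩
  refine ⟨fun i => .cons (hadj a (σ i)) (.cons (hadj i (σ i)).symm (.cons (hadj i b) .nil)),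
    fun i j hij => ?_⟩
  have hij' : σ i ≠ σ j := hσ.ne hij
  have hσb : ∀ i, σ i = b → i = a := fun i h => hσ (h.trans hσa.symm)
  simp only [Walk.edges_cons, Walk.edges_nil, List.disjoint_cons_left, List.disjoint_nil_left,
    List.mem_cons, List.not_mem_nil, Sym2.eq_iff, Sum.inl.injEq, Sum.inr.injEq, reduceCtorEq]
  grind

lemma exists_disjoint_walks_completeBipartiteGraph (hn : k ≤ n) (u v : Fin k ⊕ Fin n)
    (huv : u ≠ v) : ∃ P : Fin k → (completeBipartiteGraph (Fin k) (Fin n)).Walk u v,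
      ∀ i j, i ≠ j → (P i).edges.Disjoint (P j).edges := by
  have hadj : ∀ a b, (completeBipartiteGraph (Fin k) (Fin n)).Adj (.inl a) (.inr b) := by simp
  obtain a | b := u <;> obtain a' | b' := v
  · refine ⟨fun i => .cons (hadj a (Fin.castLE hn i))
      (.cons (hadj a' (Fin.castLE hn i)).symm .nil), fun i j hij => ?_⟩
    have hij' : Fin.castLE hn i ≠ Fin.castLE hn j := (Fin.castLE_injective hn).ne hij
    simp only [Walk.edges_cons, Walk.edges_nil, List.Disjoint, List.mem_cons, List.not_mem_nil]
    grind
  · exact exists_disjoint_walks_completeBipartiteGraph_inl_inr hn a b'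
  · obtain ⟨P, hP⟩ := exists_disjoint_walks_completeBipartiteGraph_inl_inr hn a' b
    refine ⟨fun i => (P i).reverse, fun i j hij => ?_⟩
    rw [Walk.edges_reverse, Walk.edges_reverse, List.disjoint_reverse_left,
      List.disjoint_reverse_right]
    exact hP i j hij
  · refine ⟨fun i => .cons (hadj i b).symm (.cons (hadj i b') .nil), fun i j hij => ?_⟩
    simp only [Walk.edges_cons, Walk.edges_nil, List.Disjoint, List.mem_cons, List.not_mem_nil]
    grind

theorem one_mem_mcColorCounts_completeBipartiteGraph (hk : 0 < k) (hn : k ≤ n) :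
    1 ∈ mcColorCounts (completeBipartiteGraph (Fin k) (Fin n)) k := by
  set Γ : (completeBipartiteGraph (Fin k) (Fin n)).edgeSet → Unit := fun _ => ()
  have hsurj : Function.Surjective Γ := fun _ =>
    ⟨⟨s(.inl ⟨0, hk⟩, .inr ⟨0, hk.trans_le hn⟩), by simp⟩, rfl⟩
  have hΓ : IsMCColoring (Fintype.card (Fin k)) Γ := by
    refine isMCColoring_of_walks fun u v huv => ?_
    obtain ⟨P, hP⟩ := exists_disjoint_walks_completeBipartiteGraph hn u v huv
    exact ⟨P, fun _ _ _ _ _ => rfl, hP⟩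
  rw [Fintype.card_fin] at hΓ
  simpa only [Nat.card_unique] using mem_mcColorCounts hsurj hΓ

end MonochromaticBipartite

end MonochromaticConnection

theorem theorem2p1 :
    (∀ (V : Type*) [Finite V] [Nontrivial V] (G : SimpleGraph V), G.IsEdgeConnected 2 →
      SimpleGraph.MCFormula G 2) ∧
    (∀ n : ℕ, 2 ≤ n →
      (SimpleGraph.completeGraph (Fin (2 * n + 1))).IsEdgeConnected (2 * n) ∧
      SimpleGraph.MCFormula (SimpleGraph.completeGraph (Fin (2 * n + 1))) (2 * n) ∧
      SimpleGraph.mc (SimpleGraph.completeGraph (Fin (2 * n + 1))) (2 * n) = n) ∧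
    (∀ k n : ℕ, 4 ≤ k → Even k → k ≤ n →
      (completeBipartiteGraph (Fin k) (Fin n)).IsEdgeConnected k ∧
      SimpleGraph.MCFormula (completeBipartiteGraph (Fin k) (Fin n)) k ∧
      SimpleGraph.mc (completeBipartiteGraph (Fin k) (Fin n)) k = k / 2) ∧
    (∀ n : ℕ, 3 ≤ n →
      (completeBipartiteGraph (Fin 3) (Fin n)).IsEdgeConnected 3 ∧
      SimpleGraph.MCFormula (completeBipartiteGraph (Fin 3) (Fin n)) 3 ∧
      SimpleGraph.mc (completeBipartiteGraph (Fin 3) (Fin n)) 3 = 1) := by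
  refine ⟨fun V _ _ G hG => MonochromaticConnection.mcFormula_two hG,
    fun n hn => ?_, fun k n hk hev hn => ?_, fun n hn => ?_⟩
  · have : NeZero n := ⟨by omega⟩
    exact MonochromaticConnection.mcFormula_completeGraph
  · obtain ⟨m, rfl⟩ := hev.two_dvd
    have : NeZero m := ⟨by omega⟩
    have : NeZero n := ⟨by omega⟩
    refine MonochromaticConnection.mcFormula_completeBipartiteGraph (by omega) ?_
    rw [Nat.mul_div_cancel_left m two_pos]
    exact MonochromaticConnection.mem_mcColorCounts_completeBipartiteGraph_two_mul hn
  · have : NeZero n := ⟨by omega⟩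
    exact MonochromaticConnection.mcFormula_completeBipartiteGraph (by norm_num)
      (MonochromaticConnection.one_mem_mcColorCounts_completeBipartiteGraph (by norm_num) hn)
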